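/- Let $c\ge 1$, $\sigma,\mu\in\mathbb R$ and $C>0$ be fixed, and let $(n,m)$ run through a sequence of pairs of positive integers with $n\to\infty$, $m/n\to c$ and $cn-m\to\sigma$. For each $(n,m)$ let $X$ be a random vector in $\mathbb R^n$ with law $\frac1{Z}e^{-V(x)}\,dx$, where $V=V_{n,m}\colon\mathbb R^n\to\mathbb R$ is $C^2$ with $\mathrm{Hess}\,V\ge \frac1C I_n$ everywhere; assume that $X$ is centred with covariance $I_n$, that $\mathbb E[X_i^4]=\mu$ for all $i$, and that the law of $X$ is invariant under permutations of the coordinates. Let $Y_{n,m}$ be the $n\times m$ matrix whose columns are $m$ independent copies of $\frac1{\sqrt n}X$, let $$W_{n,m}=\begin{pmatrix}0&Y_{n,m}^*\\ Y_{n,m}&0\end{pmatrix},\qquad F_{n,m}=\frac1{n+m}\sum_{i=1}^{n+m}\delta_{\lambda_i},\qquad s_{n,m}(z)=\int_{\mathbb R}\frac{F_{n,m}(dx)}{x-z},$$ where $\lambda_1,\dots,\lambda_{n+m}$ are the eigenvalues of $W_{n,m}$. For $v_0>0$ and $R>0$ let $\mathbb C_{v_0}=\{z\in\mathbb C: |\Im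 z|\ge v_0,\ |z|<R\}$. For $z\in\mathbb{C}\setminus\mathbb R$ let $D(z)$ be the square root of $$(z^2-c+1)^2-4z^2=(z^2+c-1)^2-4cz^2=\bigl(z^2-(\sqrt c+1)^2\bigr)\bigl(z^2-(\sqrt c-1)^2\bigr)$$ given by the product of the principal square roots of the last two factors (this is the branch that is analytic off the real axis and equivalent to $z^2$ at infinity), and put $$s^1(z)=-\frac1{2z}\bigl(z^2-c+1-D(z)\bigr),\quad s^2(z)=-\frac1{2cz}\bigl(z^2+c-1-D(z)\bigr),\quad s(z)=\frac{s^1(z)+c\,s^2(z)}{1+c}.$$ Then $s(z)=-\frac1{1+c}\Bigl(z-\frac{D(z)}{z}\Bigr)$, the function $s$ is the Stieltjes transform $\int\frac{F(dx)}{x-z}$ of a probability measure $F$ on $\mathbb R$, and, for every fixed $R$: 1. $s_{n,m}(z)$ is square integrable for every $z\notin\mathbb{R}$, and if $v_0=v_0(n,m)\ge n^{-1/13}$ then $s_{n,m}(z)\to s(z)$ in $L^2$ uniformly on $\mathbb C_{v_0}$, that is, $$\sup_{z\in\mathbb C_{v_0}}\bigl(\mathbb E|s_{n,m}(z)-s(z)|^2\bigr)^{1/2}\to0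 .$$ 2. $\mathbb E[s_{n,m}(z)]-s(z)=O(v_0^{-12}/n)$ uniformly: there is a constant $K$ such that for all sufficiently late pairs $(n,m)$ in the sequence, all $v_0\ge n^{-1/13}$ and all $z\in\mathbb C_{v_0}$, $$\bigl|\mathbb E[s_{n,m}(z)]-s(z)\bigr|\le K\,\frac{v_0^{-12}}{n}.$$ -/

import Mathlib

open MeasureTheory ProbabilityTheory Filter Topology
open scoped ENNReal

noncomputable section

namespace Wishart

/-- The probability law `Z⁻¹ exp (-V x) dx` on `ℝⁿ`, where `Z = ∫ exp (-V y) dy`. -/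
def gibbs {n : ℕ} (V : EuclideanSpace ℝ (Fin n) → ℝ) : Measure (EuclideanSpace ℝ (Fin n)) :=
  volume.withDensity fun x => ENNReal.ofReal (Real.exp (-V x) / ∫ y, Real.exp (-V y))

/-- The assumptions on the law of one column: `V` is of class `C²` with Hessian bounded below
by `C⁻¹ I`, and the law `gibbs V` is centred, has identity covariance, has all its fourth moments
equal to `μ`, and is invariant under permutations of the coordinates. -/
structure ColumnLaw {n : ℕ} (C μ : ℝ) (V : EuclideanSpace ℝ (Fin n) → ℝ) : Prop where
  contDiff : ContDiff ℝ 2 V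
  hessian : ∀ x y : EuclideanSpace ℝ (Fin n),
    1 / C * ‖y‖ ^ 2 ≤ iteratedFDeriv ℝ 2 V x ![y, y]
  mean : ∀ i, ∫ x, x i ∂(gibbs V) = 0
  covariance : ∀ i j, ∫ x, x i * x j ∂(gibbs V) = if i = j then 1 else 0
  fourth : ∀ i, ∫ x, x i ^ 4 ∂(gibbs V) = μ
  symmetric : ∀ σ : Equiv.Perm (Fin n),
    (gibbs V).map (fun x => WithLp.toLp 2 (fun i => x (σ i))) = gibbs V

/-- The `n × m` matrix whose columns are `X j / √n`. -/
def columnMatrix {n m : ℕ} (X : Fin m → EuclideanSpace ℝ (Fin n)) :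
    Matrix (Fin n) (Fin m) ℝ :=
  Matrix.of fun i j => X j i / √(n : ℝ)

/-- The symmetric block matrix `W = [[0, Y*], [Y, 0]]` of size `m + n`. -/
def blockMatrix {n m : ℕ} (X : Fin m → EuclideanSpace ℝ (Fin n)) :
    Matrix (Fin m ⊕ Fin n) (Fin m ⊕ Fin n) ℝ :=
  Matrix.fromBlocks 0 (columnMatrix X).conjTranspose (columnMatrix X) 0

theorem blockMatrix_isHermitian {n m : ℕ} (X : Fin m → EuclideanSpace ℝ (Fin n)) :
    (blockMatrix X).IsHermitian := by
  rw [Matrix.IsHermitian, blockMatrix, Matrix.fromBlocks_conjTranspose]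
  simp

/-- The empirical spectral distribution of a Hermitian matrix. -/
def empiricalSpectral {ι : Type*} [Fintype ι] [DecidableEq ι] {A : Matrix ι ι ℝ}
    (hA : A.IsHermitian) : Measure ℝ :=
  (Fintype.card ι : ℝ≥0∞)⁻¹ • ∑ i, Measure.dirac (hA.eigenvalues i)

/-- The Stieltjes transform `∫ (x - z)⁻¹ dF(x)`. -/
def stieltjes (F : Measure ℝ) (z : ℂ) : ℂ := ∫ x : ℝ, ((x : ℂ) - z)⁻¹ ∂F

/-- The Stieltjes transform of the empirical spectral distribution of `W`. -/
def sEmp {n m : ℕ} (X : Fin m → EuclideanSpace ℝ (Fin n)) (z : ℂ) : ℂ :=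
  stieltjes (empiricalSpectral (blockMatrix_isHermitian X)) z

/-- The domain `{z : |Im z| ≥ v₀, |z| < R}`. -/
def domain (v₀ R : ℝ) : Set ℂ := {z | v₀ ≤ |z.im| ∧ ‖z‖ < R}

/-- The square root of
`(z² - c + 1)² - 4 z² = (z² + c - 1)² - 4 c z² = (z² - (√c + 1)²) (z² - (√c - 1)²)`
that is analytic off the real axis and equivalent to `z²` at infinity: the product of the
principal square roots of the two factors. -/
def branchSqrt (c : ℝ) (z : ℂ) : ℂ :=
  (z ^ 2 - (((√c + 1) ^ 2 : ℝ) : ℂ)) ^ (1 / 2 : ℂ) * (z ^ 2 - (((√c - 1) ^ 2 : ℝ) : ℂ)) ^ (1 / 2 : ℂ)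

theorem branchSqrt_sq {c : ℝ} (hc : 0 ≤ c) (z : ℂ) :
    branchSqrt c z ^ 2 = (z ^ 2 - c + 1) ^ 2 - 4 * z ^ 2 ∧
    branchSqrt c z ^ 2 = (z ^ 2 + c - 1) ^ 2 - 4 * c * z ^ 2 := by
  have hs : ((√c : ℝ) : ℂ) ^ 2 = (c : ℂ) := by exact_mod_cast Real.sq_sqrt hc
  have key : ∀ w : ℂ, (w ^ (1 / 2 : ℂ)) ^ 2 = w := fun w => by
    rw [← Complex.cpow_nat_mul]
    norm_num
  have h : branchSqrt c z ^ 2 =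
      (z ^ 2 - ((√c : ℝ) + 1) ^ 2) * (z ^ 2 - ((√c : ℝ) - 1) ^ 2) := by
    rw [branchSqrt, mul_pow, key, key]
    push_cast
    ring
  rw [h, ← hs]
  constructor <;> ring

/-- The limit of the normalized trace of the `n × n` block of the resolvent. -/
def s₁ (c : ℝ) (z : ℂ) : ℂ := -(1 / (2 * z)) * (z ^ 2 - c + 1 - branchSqrt c z)

/-- The limit of the normalized trace of the `m × m` block of the resolvent. -/
def s₂ (c : ℝ) (z : ℂ) : ℂ := -(1 / (2 * c * z)) * (z ^ 2 + c - 1 - branchSqrt c z)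

/-- The limiting Stieltjes transform. -/
def sLim (c : ℝ) (z : ℂ) : ℂ := (s₁ c z + c * s₂ c z) / (1 + c)

end Wishart

end

/-!
The proof compares the expected normalized trace of a block of the resolvent of `W` with the
solution of a quadratic equation, with explicit errors, for each fixed `(n, m)`.

*Concentration.* Maurey's argument derives from the Prékopa–Leindler inequality that
`E exp φ · E exp (-φ) ≤ exp (C L²)` for every `L`-Lipschitz function `φ` of a column `X`, because
the Hessian bound makes `V` strongly midpoint convex
(`Wishart.ColumnLaw.lipschitzConcentration`). As the square root of a nonnegative quadratic form is
Lipschitz, a quadratic form `∑ αᵢ ⟨uᵢ, X⟩²` with `|αᵢ| ≤ B` in an orthonormal basis has mean `∑ αᵢ`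
and variance of order `n B²` (`Isotropic.variance_form_le`).

*The self-consistent equation.* Let `f = (1/n) tr (z (Y Y* - z²)⁻¹)` with `Im z > 0`, and let `q j`
be the quadratic form of the `j`-th column of `Y` in `z (Y Y* - z²)⁻¹`, the latter formed without
that column. The Sherman–Morrison formula gives
`f + (1 - m/n) / z = -(1/n) ∑ j, 1 / (z + q j)` (`Wishart.blockTrace_add`) and shows that removing
a column changes `f` by at most `1 / (n Im z)`. Hence `f` has variance of order `1/n` by bounded
differences, each `q j` is within `O(1/n)` of `a = E f` in mean and `O(n^(-1/2))` in `L²`, and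
expanding `1 / (z + q j)` to second order at `a` yields
`a + (1 - m/n) / z + (m/n) / (z + a) = O(1/n)` (`Wishart.norm_selfConsistent_le`). The first order
term is only evaluated in mean, which is why the error is `1/n` and not `n^(-1/2)`.

*Stability.* The equation of the limit is `s² + (z - (c - 1)/z) s + 1 = 0`, and `s₁` is its root
with nonnegative imaginary part. The value of the quadratic at `a` is
`(a - s₁) (a + s₁ + z - (c - 1)/z)`, and the second factor has imaginary part at least `Im z` since
`c ≥ 1` (`Wishart.norm_sub_s₁_mul_im_le`). So `a - s₁` is `O(1/n)` with a power of `1 / Im z`, and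
the `m × m` block of the resolvent is recovered from the `n × n` block. The lower half plane
follows by the symmetry `z ↦ -z` of the spectrum.

*The limiting measure.* The empirical spectral measures have bounded second moment in mean, so they
may be chosen in a weakly compact set with Stieltjes transform close to `s` at any finite number of
points. The finite intersection property gives the measure with Stieltjes transform `s`
(`Wishart.exists_stieltjes_eq_sLim`).
-/

noncomputable section

/-! ### The Prékopa–Leindler inequality -/

/-- The midpoint form of the Brunn–Minkowski inequality on the line. -/
theorem Real.volume_add_volume_le_two_mul_of_midpoint_mem {A B D : Set ℝ}
    (hA : MeasurableSet A) (hB : MeasurableSet B) (hA' : A.Nonempty) (hB' : B.Nonempty)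
    (hD : ∀ x ∈ A, ∀ y ∈ B, (x + y) / 2 ∈ D) :
    volume A + volume B ≤ 2 * volume D := by
  have key : ∀ K ⊆ A, IsCompact K → K.Nonempty → ∀ L ⊆ B, IsCompact L → L.Nonempty →
      volume K + volume L ≤ 2 * volume D := by
    intro K hKA hK hK0 L hLB hL hL0
    obtain ⟨a, ha, ha'⟩ := hK.exists_isGreatest hK0
    obtain ⟨b, hb, hb'⟩ := hL.exists_isLeast hL0
    -- `K + min L` and `max K + L` meet in one point only.
    have hsub : (fun x => b + x) '' K ∪ (fun x => a + x) '' L ⊆ (fun x => 2 * x) '' D := by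
      rintro _ (⟨x, hx, rfl⟩ | ⟨x, hx, rfl⟩)
      · exact ⟨_, hD x (hKA hx) b (hLB hb), by simp only; ring⟩
      · exact ⟨_, hD a (hKA ha) x (hLB hx), by simp only; ring⟩
    have hdisj : AEDisjoint volume ((fun x => b + x) '' K) ((fun x => a + x) '' L) := by
      refine measure_mono_null (t := {a + b}) ?_ Real.volume_singleton
      rintro _ ⟨⟨x, hx, rfl⟩, ⟨y, hy, hxy⟩⟩
      have h1 := ha' hx
      have h2 := hb' hy
      simp only at hxy
      simp only [Set.mem_singleton_iff]
      linarith
    have hm : MeasurableSet ((fun x => a + x) '' L) :=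
      (hL.image (by fun_prop)).measurableSet
    calc volume K + volume L
        = volume ((fun x => b + x) '' K) + volume ((fun x => a + x) '' L) := by
          simp [Set.image_add_left, measure_preimage_add]
      _ = volume ((fun x => b + x) '' K ∪ (fun x => a + x) '' L) :=
          (measure_union₀ hm.nullMeasurableSet hdisj).symm
      _ ≤ volume ((fun x => 2 * x) '' D) := measure_mono hsub
      _ = 2 * volume D := by
          have := Measure.addHaar_smul (volume : Measure ℝ) 2 D
          rw [← Set.image_smul] at this
          simpa using this
  obtain ⟨x₀, hx₀⟩ := hA'
  obtain ⟨y₀, hy₀⟩ := hB'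
  have key' : ∀ K, K ⊆ A ∧ IsCompact K → ∀ L, L ⊆ B ∧ IsCompact L →
      volume K + volume L ≤ 2 * volume D := fun K hK L hL =>
    (add_le_add (measure_mono (Set.subset_insert x₀ K))
      (measure_mono (Set.subset_insert y₀ L))).trans <|
      key _ (Set.insert_subset hx₀ hK.1) (hK.2.insert _) (Set.insert_nonempty _ _)
        _ (Set.insert_subset hy₀ hL.1) (hL.2.insert _) (Set.insert_nonempty _ _)
  rw [hA.measure_eq_iSup_isCompact volume, hB.measure_eq_iSup_isCompact volume]
  simp only [iSup_and']
  exact ENNReal.biSup_add_biSup_le' (p := fun K => K ⊆ A ∧ IsCompact K)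
    (q := fun L => L ⊆ B ∧ IsCompact L) ⟨∅, by simp⟩ ⟨∅, by simp⟩ key'

/-- The one-dimensional inequality for functions with supremum one, where it holds in its
arithmetic form. -/
theorem lintegral_add_lintegral_le_of_midpoint {f g h : ℝ → ℝ} (hf : Measurable f)
    (hg : Measurable g) (hh : Measurable h) (hf0 : 0 ≤ f) (hg0 : 0 ≤ g) (hh0 : 0 ≤ h)
    (hf1 : ∀ x, f x ≤ 1) (hg1 : ∀ x, g x ≤ 1) (hf2 : ∀ t, 0 < t → t < 1 → ∃ x, t < f x)
    (hg2 : ∀ t, 0 < t → t < 1 → ∃ x, t < g x) (H : ∀ x y, f x * g y ≤ h ((x + y) / 2) ^ 2) :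
    (∫⁻ x, ENNReal.ofReal (f x)) + (∫⁻ x, ENNReal.ofReal (g x)) ≤
      2 * ∫⁻ x, ENNReal.ofReal (h x) := by
  rw [lintegral_eq_lintegral_meas_lt _ (.of_forall hf0) hf.aemeasurable,
    lintegral_eq_lintegral_meas_lt _ (.of_forall hg0) hg.aemeasurable,
    lintegral_eq_lintegral_meas_lt _ (.of_forall hh0) hh.aemeasurable]
  have anti : ∀ u : ℝ → ℝ, Measurable fun t : ℝ => volume {a | t < u a} := fun u =>
    Antitone.measurable fun s t hst => measure_mono fun a (ha : t < u a) => hst.trans_lt ha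
  rw [← lintegral_add_left (anti f), ← lintegral_const_mul _ (anti h)]
  refine setLIntegral_mono ((anti h).const_mul _) fun t (ht : 0 < t) => ?_
  rcases lt_or_ge t 1 with h1 | h1
  · refine Real.volume_add_volume_le_two_mul_of_midpoint_mem (hf measurableSet_Ioi)
      (hg measurableSet_Ioi) (hf2 t ht h1) (hg2 t ht h1) fun x hx y hy => ?_
    have hx' : t < f x := hx
    have hy' : t < g y := hy
    have := H x y
    exact lt_of_pow_lt_pow_left₀ 2 (hh0 _) (by nlinarith)
  · have e1 : {a | t < f a} = ∅ := by ext a; simpa using (hf1 a).trans h1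
    have e2 : {a | t < g a} = ∅ := by ext a; simpa using (hg1 a).trans h1
    simp [e1, e2]

theorem ENNReal.mul_le_sq_of_add_le {a b c : ℝ≥0∞} (h : a + b ≤ 2 * c) : a * b ≤ c ^ 2 := by
  rcases eq_or_ne c ∞ with rfl | hc
  · simp
  have hab : a + b ≠ ∞ := ne_top_of_le_ne_top (by finiteness) h
  lift c to NNReal using hc
  lift a to NNReal using (ENNReal.add_ne_top.1 hab).1
  lift b to NNReal using (ENNReal.add_ne_top.1 hab).2
  norm_cast at h ⊢
  have h' : (a : ℝ) + b ≤ 2 * c := by exact_mod_cast h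
  have : (a : ℝ) * b ≤ (c : ℝ) ^ 2 := by
    nlinarith [sq_nonneg ((a : ℝ) - b), a.2, b.2, c.2, NNReal.coe_nonneg a, NNReal.coe_nonneg b]
  exact_mod_cast this

/-- The measure `μ` satisfies the Prékopa–Leindler inequality with equal weights. -/
def PrekopaLeindler {E : Type*} [AddCommGroup E] [Module ℝ E] [MeasurableSpace E]
    (μ : Measure E) : Prop :=
  ∀ f g h : E → ℝ≥0∞, Measurable f → Measurable g → Measurable h →
    (∀ x y, f x * g y ≤ h ((1 / 2 : ℝ) • (x + y)) ^ 2) →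
    (∫⁻ x, f x ∂μ) * (∫⁻ x, g x ∂μ) ≤ (∫⁻ x, h x ∂μ) ^ 2

/-- Normalizing `f` and `g` by their suprema reduces the multiplicative inequality to the
arithmetic one. -/
theorem PrekopaLeindler.real_of_bounded {f g h : ℝ → ℝ≥0∞} (hf : Measurable f)
    (hg : Measurable g) (hh : Measurable h) {k : NNReal} (hfk : ∀ x, f x ≤ k) (hgk : ∀ x, g x ≤ k)
    (hhk : ∀ x, h x ≤ k) (H : ∀ x y, f x * g y ≤ h ((x + y) / 2) ^ 2) :
    (∫⁻ x, f x) * (∫⁻ x, g x) ≤ (∫⁻ x, h x) ^ 2 := by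
  set F := ⨆ x, f x with hF
  set G := ⨆ x, g x with hG
  have hFt : F ≠ ∞ := ne_top_of_le_ne_top (by finiteness) (iSup_le hfk)
  have hGt : G ≠ ∞ := ne_top_of_le_ne_top (by finiteness) (iSup_le hgk)
  rcases eq_or_ne F 0 with h0 | hF0
  · have : ∀ x, f x = 0 := by simpa [hF] using h0
    simp [this]
  rcases eq_or_ne G 0 with h0 | hG0
  · have : ∀ x, g x = 0 := by simpa [hG] using h0
    simp [this]
  have hA : 0 < F.toReal := ENNReal.toReal_pos hF0 hFt
  have hB : 0 < G.toReal := ENNReal.toReal_pos hG0 hGt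
  set A := F.toReal with hAdef
  set B := G.toReal with hBdef
  have fin : ∀ {u : ℝ → ℝ≥0∞}, (∀ x, u x ≤ k) → ∀ x, u x ≠ ∞ := fun hu x =>
    ne_top_of_le_ne_top (by finiteness) (hu x)
  -- rescaling an integral of real parts
  have resc : ∀ {u : ℝ → ℝ≥0∞}, Measurable u → (∀ x, u x ≤ k) → ∀ r : ℝ, 0 < r →
      ∫⁻ x, u x = ENNReal.ofReal r * ∫⁻ x, ENNReal.ofReal ((u x).toReal / r) := by
    intro u hu huk r hr
    rw [← lintegral_const_mul _ (by fun_prop)]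
    refine lintegral_congr fun x => ?_
    rw [← ENNReal.ofReal_mul hr.le, mul_div_cancel₀ _ hr.ne', ENNReal.ofReal_toReal (fin huk x)]
  have hAB : 0 < √(A * B) := Real.sqrt_pos.2 (mul_pos hA hB)
  have main := lintegral_add_lintegral_le_of_midpoint
    (f := fun x => (f x).toReal / A) (g := fun x => (g x).toReal / B)
    (h := fun x => (h x).toReal / √(A * B)) (by fun_prop) (by fun_prop) (by fun_prop)
    (fun x => by positivity) (fun x => by positivity) (fun x => by positivity)
    (fun x => by
      rw [div_le_one hA]; exact ENNReal.toReal_mono hFt (le_iSup f x))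
    (fun x => by
      rw [div_le_one hB]; exact ENNReal.toReal_mono hGt (le_iSup g x))
    (fun t ht ht1 => by
      have : ENNReal.ofReal (t * A) < F :=
        (ENNReal.ofReal_lt_iff_lt_toReal (by positivity) hFt).2 (by nlinarith)
      obtain ⟨x, hx⟩ := lt_iSup_iff.1 this
      exact ⟨x, (lt_div_iff₀ hA).2
        ((ENNReal.ofReal_lt_iff_lt_toReal (by positivity) (fin hfk x)).1 hx)⟩)
    (fun t ht ht1 => by
      have : ENNReal.ofReal (t * B) < G :=
        (ENNReal.ofReal_lt_iff_lt_toReal (by positivity) hGt).2 (by nlinarith)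
      obtain ⟨x, hx⟩ := lt_iSup_iff.1 this
      exact ⟨x, (lt_div_iff₀ hB).2
        ((ENNReal.ofReal_lt_iff_lt_toReal (by positivity) (fin hgk x)).1 hx)⟩)
    (fun x y => by
      have h1 := ENNReal.toReal_mono (by have := fin hhk ((x + y) / 2); finiteness) (H x y)
      rw [ENNReal.toReal_mul, ENNReal.toReal_pow] at h1
      rw [div_mul_div_comm, div_pow, Real.sq_sqrt (by positivity)]
      gcongr)
  rw [resc hf hfk A hA, resc hg hgk B hB, resc hh hhk _ hAB]
  have := ENNReal.mul_le_sq_of_add_le main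
  calc _ = ENNReal.ofReal A * ENNReal.ofReal B *
        ((∫⁻ x, ENNReal.ofReal ((f x).toReal / A)) * ∫⁻ x, ENNReal.ofReal ((g x).toReal / B)) := by
        ring
    _ ≤ ENNReal.ofReal A * ENNReal.ofReal B *
        (∫⁻ x, ENNReal.ofReal ((h x).toReal / √(A * B))) ^ 2 := by gcongr
    _ = _ := by
      rw [mul_pow, ← ENNReal.ofReal_mul hA.le, ← ENNReal.ofReal_pow hAB.le,
        Real.sq_sqrt (by positivity)]

theorem PrekopaLeindler.real : PrekopaLeindler (volume : Measure ℝ) := by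
  intro f g h hf hg hh H
  have trunc : ∀ {u : ℝ → ℝ≥0∞}, Measurable u →
      ∫⁻ x, u x = ⨆ k : ℕ, ∫⁻ x, min (u x) k := by
    intro u hu
    rw [← lintegral_iSup (fun k => by fun_prop)]
    · refine lintegral_congr fun x => ?_
      rw [← inf_iSup_eq, ENNReal.iSup_natCast, inf_top_eq]
    · intro i j hij x
      exact min_le_min le_rfl (by exact_mod_cast hij)
  have mono : ∀ u : ℝ → ℝ≥0∞, Monotone fun k : ℕ => ∫⁻ x, min (u x) k := fun u i j hij =>
    lintegral_mono fun x => min_le_min le_rfl (by exact_mod_cast hij)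
  rw [trunc hf, trunc hg, ENNReal.iSup_mul]
  refine iSup_le fun i => ?_
  rw [ENNReal.mul_iSup]
  refine iSup_le fun j => ?_
  set k := max i j
  calc _ ≤ (∫⁻ x, min (f x) k) * ∫⁻ x, min (g x) k :=
        mul_le_mul' (mono f (le_max_left i j)) (mono g (le_max_right i j))
    _ ≤ (∫⁻ x, min (h x) k) ^ 2 := by
        refine PrekopaLeindler.real_of_bounded (k := k) (by fun_prop) (by fun_prop) (by fun_prop)
          (fun x => by simp) (fun x => by simp) (fun x => by simp) fun x y => ?_
        have := H x y
        rw [smul_eq_mul, one_div_mul_eq_div] at this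
        rcases min_cases (h ((x + y) / 2)) (k : ℝ≥0∞) with h | h
        · rw [h.1]
          exact (mul_le_mul' (min_le_left _ _) (min_le_left _ _)).trans this
        · rw [h.1, sq]
          exact mul_le_mul' (min_le_right _ _) (min_le_right _ _)
    _ ≤ _ := by gcongr; exact min_le_left _ _

theorem PrekopaLeindler.prod {E F : Type*} [AddCommGroup E] [Module ℝ E] [MeasurableSpace E]
    [AddCommGroup F] [Module ℝ F] [MeasurableSpace F] {μ : Measure E} {ν : Measure F}
    [SFinite ν] (hμ : PrekopaLeindler μ) (hν : PrekopaLeindler ν) :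
    PrekopaLeindler (μ.prod ν) := by
  intro f g h hf hg hh H
  rw [lintegral_prod _ hf.aemeasurable, lintegral_prod _ hg.aemeasurable,
    lintegral_prod _ hh.aemeasurable]
  refine hμ _ _ _ hf.lintegral_prod_right' hg.lintegral_prod_right' hh.lintegral_prod_right'
    fun x y => hν _ _ _ (by fun_prop) (by fun_prop) (by fun_prop) fun a b => ?_
  simpa using H (x, a) (y, b)

theorem PrekopaLeindler.of_measurePreserving {E F : Type*} [AddCommGroup E] [Module ℝ E]
    [MeasurableSpace E] [AddCommGroup F] [Module ℝ F] [MeasurableSpace F] {μ : Measure E}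
    {ν : Measure F} (hμ : PrekopaLeindler μ) (e : E →ₗ[ℝ] F) (he : MeasurePreserving e μ ν) :
    PrekopaLeindler ν := by
  intro f g h hf hg hh H
  rw [← he.lintegral_comp hf, ← he.lintegral_comp hg, ← he.lintegral_comp hh]
  refine hμ _ _ _ (hf.comp he.measurable) (hg.comp he.measurable) (hh.comp he.measurable)
    fun x y => ?_
  simpa using H (e x) (e y)

theorem PrekopaLeindler.fin_pi (n : ℕ) : PrekopaLeindler (volume : Measure (Fin n → ℝ)) := by
  induction n with
  | zero =>
    intro f g h hf hg hh H
    rw [volume_pi, Measure.pi_of_empty, lintegral_dirac' _ hf, lintegral_dirac' _ hg,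
      lintegral_dirac' _ hh]
    convert H _ _ using 3
  | succ n ih =>
    let e : (ℝ × (Fin n → ℝ)) →ₗ[ℝ] (Fin (n + 1) → ℝ) :=
      { toFun := fun p => Fin.cons p.1 p.2
        map_add' := fun p q => by ext i; refine Fin.cases ?_ (fun j => ?_) i <;> simp
        map_smul' := fun r p => by ext i; refine Fin.cases ?_ (fun j => ?_) i <;> simp }
    refine (PrekopaLeindler.real.prod ih).of_measurePreserving e ?_
    have := (volume_preserving_piFinSuccAbove (fun _ : Fin (n + 1) => ℝ) 0).symm
    have he : ⇑e = (MeasurableEquiv.piFinSuccAbove (fun _ : Fin (n + 1) => ℝ) 0).symm := by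
      ext p : 1
      simp [e, MeasurableEquiv.piFinSuccAbove, Fin.consEquiv]
    rw [he]
    exact this

theorem PrekopaLeindler.euclideanSpace (n : ℕ) :
    PrekopaLeindler (volume : Measure (EuclideanSpace ℝ (Fin n))) :=
  (PrekopaLeindler.fin_pi n).of_measurePreserving
    (WithLp.linearEquiv 2 ℝ (Fin n → ℝ)).symm.toLinearMap (PiLp.volume_preserving_toLp (Fin n))

/-! ### Concentration for uniformly log-concave laws -/

/-- Exponential concentration of Lipschitz functions under `γ`, in a form that does not refer to
the mean of the function. -/
def LipschitzConcentration {E : Type*} [PseudoEMetricSpace E] [MeasurableSpace E] (C : ℝ)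
    (γ : Measure E) : Prop :=
  ∀ (L : NNReal) (φ : E → ℝ), LipschitzWith L φ →
    (∫⁻ x, ENNReal.ofReal (Real.exp (φ x)) ∂γ) * (∫⁻ x, ENNReal.ofReal (Real.exp (-φ x)) ∂γ) ≤
      ENNReal.ofReal (Real.exp (C * L ^ 2))

/-- A lower bound on the Hessian gives midpoint strong convexity. -/
theorem strong_midpoint_convex_of_hessian {E : Type*} [NormedAddCommGroup E] [NormedSpace ℝ E]
    {V : E → ℝ} {κ : ℝ} (hV : ContDiff ℝ 2 V)
    (hess : ∀ x y, κ * ‖y‖ ^ 2 ≤ iteratedFDeriv ℝ 2 V x ![y, y]) (x y : E) :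
    2 * V ((1 / 2 : ℝ) • (x + y)) + κ * ‖x - y‖ ^ 2 / 4 ≤ V x + V y := by
  set p := (1 / 2 : ℝ) • (x + y) with hp
  set u := (1 / 2 : ℝ) • (x - y) with hu
  have hl : ∀ t : ℝ, HasDerivAt (fun t : ℝ => p + t • u) u t := fun t => by
    simpa using ((hasDerivAt_id t).smul_const u).const_add p
  have hV1 : ∀ z, HasFDerivAt V (fderiv ℝ V z) z := fun z =>
    (hV.differentiable (by norm_num) z).hasFDerivAt
  have hV2 : ∀ z, HasFDerivAt (fderiv ℝ V) (fderiv ℝ (fderiv ℝ V) z) z := fun z =>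
    ((hV.fderiv_right (m := 1) (by norm_num)).differentiable (by norm_num) z).hasFDerivAt
  have g1 : ∀ t : ℝ, HasDerivAt (fun t : ℝ => V (p + t • u)) (fderiv ℝ V (p + t • u) u) t :=
    fun t => (hV1 (p + t • u)).comp_hasDerivAt t (hl t)
  have g2 : ∀ t : ℝ, HasDerivAt (fun t : ℝ => fderiv ℝ V (p + t • u))
      (fderiv ℝ (fderiv ℝ V) (p + t • u) u) t :=
    fun t => (hV2 (p + t • u)).comp_hasDerivAt t (hl t)
  have h1 : ∀ t : ℝ, HasDerivAt (fun t : ℝ => V (p + t • u) - κ * ‖u‖ ^ 2 / 2 * t ^ 2)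
      (fderiv ℝ V (p + t • u) u - κ * ‖u‖ ^ 2 * t) t := fun t => by
    have q : HasDerivAt (fun t : ℝ => κ * ‖u‖ ^ 2 / 2 * t ^ 2) (κ * ‖u‖ ^ 2 * t) t :=
      ((hasDerivAt_pow 2 t).const_mul (κ * ‖u‖ ^ 2 / 2)).congr_deriv (by simp; ring)
    exact (g1 t).sub q
  have h2 : ∀ t : ℝ, HasDerivAt (fun t : ℝ => fderiv ℝ V (p + t • u) u - κ * ‖u‖ ^ 2 * t)
      (fderiv ℝ (fderiv ℝ V) (p + t • u) u u - κ * ‖u‖ ^ 2) t := fun t => by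
    have q : HasDerivAt (fun t : ℝ => κ * ‖u‖ ^ 2 * t) (κ * ‖u‖ ^ 2) t := by
      simpa using (hasDerivAt_id t).const_mul (κ * ‖u‖ ^ 2)
    have r : HasDerivAt (fun t : ℝ => fderiv ℝ V (p + t • u) u)
        (fderiv ℝ (fderiv ℝ V) (p + t • u) u u) t := by
      simpa using (g2 t).clm_apply (hasDerivAt_const t u)
    exact r.sub q
  have e1 := funext fun t => (h1 t).deriv
  have conv : ConvexOn ℝ Set.univ (fun t : ℝ => V (p + t • u) - κ * ‖u‖ ^ 2 / 2 * t ^ 2) := by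
    refine convexOn_univ_of_deriv2_nonneg (fun t => (h1 t).differentiableAt) ?_ fun t => ?_
    · rw [e1]; exact fun t => (h2 t).differentiableAt
    · rw [Function.iterate_succ, Function.iterate_one, Function.comp_apply, e1, (h2 t).deriv]
      have := hess (p + t • u) u
      rw [iteratedFDeriv_two_apply] at this
      simpa using this
  have := conv.2 (Set.mem_univ (1 : ℝ)) (Set.mem_univ (-1 : ℝ))
    (show (0 : ℝ) ≤ 1 / 2 by norm_num) (show (0 : ℝ) ≤ 1 / 2 by norm_num) (by norm_num)
  have e2 : p + (1 : ℝ) • u = x := by rw [hp, hu]; module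
  have e3 : p + (-1 : ℝ) • u = y := by rw [hp, hu]; module
  have e4 : ‖u‖ ^ 2 = ‖x - y‖ ^ 2 / 4 := by
    rw [hu, norm_smul, mul_pow]; norm_num; ring
  simp only [smul_eq_mul, e2, e3] at this
  norm_num at this
  rw [e4] at this
  linarith

/-- A uniformly log-concave law concentrates: this is Maurey's argument, the Prékopa–Leindler
inequality for `exp (φ - V)`, `exp (-φ - V)` and a multiple of `exp (-V)`. -/
theorem Wishart.ColumnLaw.lipschitzConcentration {n : ℕ} {C μ : ℝ}
    {V : EuclideanSpace ℝ (Fin n) → ℝ} (hC : 0 < C) (hV : Wishart.ColumnLaw C μ V)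
    [IsProbabilityMeasure (Wishart.gibbs V)] : LipschitzConcentration C (Wishart.gibbs V) := by
  intro L φ hφ
  set Z := ∫ y, Real.exp (-V y) with hZ
  have hVc : Continuous V := hV.contDiff.continuous
  have hφc := hφ.continuous
  have hZ0 : Z ≠ 0 := by
    intro h
    have : Wishart.gibbs V = 0 := by
      rw [Wishart.gibbs, ← hZ, h]; simp
    exact IsProbabilityMeasure.ne_zero (Wishart.gibbs V) this
  have hZpos : 0 < Z := lt_of_le_of_ne (integral_nonneg fun x => (Real.exp_pos _).le) hZ0.symm
  have hint : Integrable fun y => Real.exp (-V y) := by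
    by_contra h; exact hZ0 (integral_undef h)
  have hZl : ∫⁻ y, ENNReal.ofReal (Real.exp (-V y)) = ENNReal.ofReal Z :=
    (ofReal_integral_eq_lintegral_ofReal hint (.of_forall fun x => (Real.exp_pos _).le)).symm
  have key : ∀ ψ : EuclideanSpace ℝ (Fin n) → ℝ, Continuous ψ →
      ∫⁻ x, ENNReal.ofReal (Real.exp (ψ x)) ∂(Wishart.gibbs V) =
        ENNReal.ofReal Z⁻¹ * ∫⁻ x, ENNReal.ofReal (Real.exp (ψ x - V x)) := by
    intro ψ hψ
    rw [Wishart.gibbs, lintegral_withDensity_eq_lintegral_mul _ (by fun_prop) (by fun_prop),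
      ← lintegral_const_mul _ (by fun_prop)]
    refine lintegral_congr fun x => ?_
    rw [Pi.mul_apply, ← ENNReal.ofReal_mul (by positivity), ← ENNReal.ofReal_mul (by positivity),
      sub_eq_neg_add, Real.exp_add]
    congr 1; rw [← hZ]; ring
  rw [key _ hφc, key (fun x => -φ x) hφc.neg]
  have PL := PrekopaLeindler.euclideanSpace n
    (fun x => ENNReal.ofReal (Real.exp (φ x - V x)))
    (fun x => ENNReal.ofReal (Real.exp (-φ x - V x)))
    (fun x => ENNReal.ofReal (Real.exp (C * L ^ 2 / 2)) * ENNReal.ofReal (Real.exp (-V x)))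
    (by fun_prop) (by fun_prop) (by fun_prop) (fun x y => by
      rw [← ENNReal.ofReal_mul (by positivity), ← ENNReal.ofReal_mul (by positivity),
        ← ENNReal.ofReal_pow (by positivity), ← Real.exp_add, ← Real.exp_add, ← Real.exp_nat_mul]
      refine ENNReal.ofReal_le_ofReal (Real.exp_le_exp.2 ?_)
      have h1 := strong_midpoint_convex_of_hessian hV.contDiff hV.hessian x y
      have h2 : φ x - φ y ≤ L * ‖x - y‖ := by
        rw [← dist_eq_norm]
        exact (le_abs_self _).trans (hφ.dist_le_mul x y)
      have h3 : L * ‖x - y‖ ≤ 1 / C * ‖x - y‖ ^ 2 / 4 + C * L ^ 2 := by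
        have : 0 ≤ (‖x - y‖ / 2 - C * L) ^ 2 / C := by positivity
        have e : (‖x - y‖ / 2 - C * L) ^ 2 / C =
          1 / C * ‖x - y‖ ^ 2 / 4 + C * L ^ 2 - L * ‖x - y‖ := by field_simp; ring
        linarith
      push_cast
      linarith)
  rw [lintegral_const_mul _ (by fun_prop), hZl] at PL
  calc _ = ENNReal.ofReal Z⁻¹ * ENNReal.ofReal Z⁻¹ *
        ((∫⁻ x, ENNReal.ofReal (Real.exp (φ x - V x))) *
          ∫⁻ x, ENNReal.ofReal (Real.exp (-φ x - V x))) := by ring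
    _ ≤ ENNReal.ofReal Z⁻¹ * ENNReal.ofReal Z⁻¹ *
        (ENNReal.ofReal (Real.exp (C * L ^ 2 / 2)) * ENNReal.ofReal Z) ^ 2 := by gcongr
    _ = ENNReal.ofReal (Real.exp (C * L ^ 2)) := by
      rw [← ENNReal.ofReal_mul (by positivity), ← ENNReal.ofReal_mul (by positivity),
        ← ENNReal.ofReal_pow (by positivity), ← ENNReal.ofReal_mul (by positivity), mul_pow,
        ← Real.exp_nat_mul]
      congr 1
      field_simp
      congr 1; push_cast; ring

namespace LipschitzConcentration

variable {E : Type*} [PseudoMetricSpace E] [MeasurableSpace E] [OpensMeasurableSpace E] {C : ℝ}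
  {γ : Measure E} [IsProbabilityMeasure γ]

theorem integrable_exp (h : LipschitzConcentration C γ) {ψ : E → ℝ} (hψ : LipschitzWith 1 ψ) :
    Integrable (fun x => Real.exp (ψ x)) γ := by
  have hc := hψ.continuous
  have h1 := h 1 ψ hψ
  have h0 : ∫⁻ x, ENNReal.ofReal (Real.exp (-ψ x)) ∂γ ≠ 0 := by
    rw [Ne, lintegral_eq_zero_iff (by fun_prop)]
    intro h2
    obtain ⟨x, hx⟩ := h2.exists
    simp [(Real.exp_pos _).not_ge] at hx
  refine ⟨by fun_prop, ?_⟩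
  rw [hasFiniteIntegral_iff_ofReal (.of_forall fun x => (Real.exp_pos _).le), lt_top_iff_ne_top]
  intro h2
  rw [h2, ENNReal.top_mul h0] at h1
  exact ENNReal.ofReal_ne_top (top_le_iff.1 h1)

theorem integrable (h : LipschitzConcentration C γ) {ψ : E → ℝ} (hψ : LipschitzWith 1 ψ) :
    Integrable ψ γ := by
  have hc := hψ.continuous
  refine ((h.integrable_exp hψ).add (h.integrable_exp hψ.neg)).mono' (by fun_prop)
    (.of_forall fun x => ?_)
  simp only [Pi.add_apply, Pi.neg_apply]
  rw [Real.norm_eq_abs, abs_le]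
  have h1 := Real.add_one_le_exp (ψ x)
  have h2 := Real.add_one_le_exp (-ψ x)
  have h3 := Real.exp_pos (ψ x)
  have h4 := Real.exp_pos (-ψ x)
  constructor <;> linarith

/-- By Jensen's inequality the factor with `-ψ` in the definition is at least one. -/
theorem integral_exp_centered_le (h : LipschitzConcentration C γ) {ψ : E → ℝ}
    (hψ : LipschitzWith 1 ψ) (h0 : ∫ x, ψ x ∂γ = 0) :
    ∫ x, Real.exp (ψ x) ∂γ ≤ Real.exp C := by
  have h1 := h 1 ψ hψ
  have i1 := h.integrable_exp hψ
  have i2 : Integrable (fun x => Real.exp (-ψ x)) γ := h.integrable_exp hψ.neg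
  rw [← ofReal_integral_eq_lintegral_ofReal i1 (.of_forall fun x => (Real.exp_pos _).le),
    ← ofReal_integral_eq_lintegral_ofReal i2 (.of_forall fun x => (Real.exp_pos _).le),
    ← ENNReal.ofReal_mul (integral_nonneg fun x => (Real.exp_pos _).le),
    ENNReal.ofReal_le_ofReal_iff (Real.exp_pos _).le] at h1
  have i3 : Integrable (fun x => -ψ x) γ := (h.integrable hψ).neg
  have h2 : 1 ≤ ∫ x, Real.exp (-ψ x) ∂γ := by
    calc (1 : ℝ) = ∫ x, (-ψ x + 1) ∂γ := by
          rw [integral_add i3 (integrable_const _), integral_neg, h0]; simp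
      _ ≤ _ := integral_mono (i3.add (integrable_const _)) i2
          fun x => Real.add_one_le_exp _
  simp only [NNReal.coe_one, one_pow, mul_one] at h1
  exact (le_mul_of_one_le_right (integral_nonneg fun x => (Real.exp_pos _).le) h2).trans h1

theorem fourth_moment (h : LipschitzConcentration C γ) {ψ : E → ℝ} (hψ : LipschitzWith 1 ψ) :
    Integrable (fun x => (ψ x - ∫ y, ψ y ∂γ) ^ 4) γ ∧
      ∫ x, (ψ x - ∫ y, ψ y ∂γ) ^ 4 ∂γ ≤ 48 * Real.exp C := by
  set M := ∫ y, ψ y ∂γ with hM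
  have hL : LipschitzWith 1 fun x => ψ x - M := by
    simpa using hψ.sub (LipschitzWith.const M)
  have hL' : LipschitzWith 1 fun x => -(ψ x - M) := hL.neg
  have h0 : ∫ x, (ψ x - M) ∂γ = 0 := by
    rw [integral_sub (h.integrable hψ) (integrable_const _)]; simp [hM]
  have hc := hψ.continuous
  have pt : ∀ t : ℝ, t ^ 4 ≤ 24 * (Real.exp t + Real.exp (-t)) := by
    have pos : ∀ t : ℝ, 0 ≤ t → t ^ 4 ≤ 24 * Real.exp t := fun t ht => by
      have := Real.pow_div_factorial_le_exp t ht 4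
      norm_num [Nat.factorial] at this
      linarith
    intro t
    rcases le_total 0 t with ht | ht
    · linarith [pos t ht, Real.exp_pos (-t)]
    · have := pos (-t) (by linarith)
      rw [Even.neg_pow (by decide)] at this
      linarith [Real.exp_pos t]
  have i1 := h.integrable_exp hL
  have i2 := h.integrable_exp hL'
  have i3 := (i1.add i2).const_mul 24
  have int4 : Integrable (fun x => (ψ x - M) ^ 4) γ := by
    refine i3.mono' (by fun_prop) (.of_forall fun x => ?_)
    rw [Real.norm_of_nonneg (by positivity)]
    exact pt _
  refine ⟨int4, (integral_mono int4 i3 fun x => pt _).trans ?_⟩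
  have h1 := h.integral_exp_centered_le hL h0
  have h2 := h.integral_exp_centered_le hL' (by rw [integral_neg, h0, neg_zero])
  rw [integral_const_mul]
  simp only [Pi.add_apply]
  rw [integral_add i1 i2]
  linarith

theorem integrable_sq (h : LipschitzConcentration C γ) {ψ : E → ℝ} (hψ : LipschitzWith 1 ψ) :
    Integrable (fun x => ψ x ^ 2) γ := by
  have hc := hψ.continuous
  have h4 := (h.fourth_moment hψ).1
  set M := ∫ y, ψ y ∂γ
  refine (((h4.const_mul 2).add (integrable_const (2 : ℝ))).add
    (integrable_const (2 * M ^ 2))).mono' (by fun_prop) (.of_forall fun x => ?_)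
  simp only [Pi.add_apply]
  rw [Real.norm_of_nonneg (by positivity)]
  nlinarith [sq_nonneg ((ψ x - M) ^ 2 - 1), sq_nonneg (ψ x - 2 * M)]

/-- The square of a Lipschitz function whose second moment is at most `n` has variance of
order `n`. -/
theorem variance_sq_le (h : LipschitzConcentration C γ) {ψ : E → ℝ} (hψ : LipschitzWith 1 ψ)
    {n : ℝ} (hn : 1 ≤ n) (h2 : ∫ x, ψ x ^ 2 ∂γ ≤ n) :
    Integrable (fun x => (ψ x ^ 2 - ∫ y, ψ y ^ 2 ∂γ) ^ 2) γ ∧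
    ∫ x, (ψ x ^ 2 - ∫ y, ψ y ^ 2 ∂γ) ^ 2 ∂γ ≤ (288 * Real.exp C + 4) * n := by
  have hc := hψ.continuous
  obtain ⟨i4, h4⟩ := h.fourth_moment hψ
  have i1 := h.integrable hψ
  have i2 := h.integrable_sq hψ
  set M := ∫ y, ψ y ∂γ with hM
  set T := ∫ y, ψ y ^ 2 ∂γ with hT
  have hMn : M ^ 2 ≤ n := by
    have : 0 ≤ ∫ x, (ψ x - M) ^ 2 ∂γ := integral_nonneg fun x => sq_nonneg _
    have e : ∫ x, (ψ x - M) ^ 2 ∂γ = T - M ^ 2 := by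
      calc _ = ∫ x, (ψ x ^ 2 - 2 * M * ψ x + M ^ 2) ∂γ := by
            congr 1; ext x; ring
        _ = _ := by
          have i5 : Integrable (fun x => ψ x ^ 2 - 2 * M * ψ x) γ := i2.sub (i1.const_mul _)
          rw [integral_add i5 (integrable_const _), integral_sub i2 (i1.const_mul _),
            integral_const_mul]
          simp [← hM, ← hT]; ring
    linarith
  have ib : Integrable (fun x => 2 * (ψ x - M) ^ 4 + 4 * n * (1 + (ψ x - M) ^ 4)) γ :=
    (i4.const_mul 2).add (((integrable_const 1).add i4).const_mul _)
  have pt : ∀ x, (ψ x ^ 2 - M ^ 2) ^ 2 ≤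
      2 * (ψ x - M) ^ 4 + 4 * n * (1 + (ψ x - M) ^ 4) := fun x => by
    have a1 : (ψ x ^ 2 - M ^ 2) ^ 2 ≤ 2 * (ψ x - M) ^ 4 + 8 * M ^ 2 * (ψ x - M) ^ 2 := by
      nlinarith [sq_nonneg ((ψ x - M) ^ 2 - 2 * M * (ψ x - M))]
    have a2 : 2 * (ψ x - M) ^ 2 ≤ 1 + (ψ x - M) ^ 4 := by
      nlinarith [sq_nonneg ((ψ x - M) ^ 2 - 1)]
    have a3 : M ^ 2 * (2 * (ψ x - M) ^ 2) ≤ n * (1 + (ψ x - M) ^ 4) := by gcongr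
    linarith
  have im : Integrable (fun x => (ψ x ^ 2 - M ^ 2) ^ 2) γ :=
    ib.mono' (by fun_prop) (.of_forall fun x => by
      rw [Real.norm_of_nonneg (by positivity)]; exact pt x)
  have e : ∀ x, (ψ x ^ 2 - T) ^ 2 =
      (ψ x ^ 2 - M ^ 2) ^ 2 - 2 * (T - M ^ 2) * ψ x ^ 2 + (T ^ 2 - (M ^ 2) ^ 2) := fun x => by ring
  simp only [e]
  have i6 : Integrable (fun x => (ψ x ^ 2 - M ^ 2) ^ 2 - 2 * (T - M ^ 2) * ψ x ^ 2) γ :=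
    im.sub (i2.const_mul _)
  refine ⟨i6.add (integrable_const _), ?_⟩
  rw [integral_add i6 (integrable_const _),
    integral_sub im (i2.const_mul _), integral_const_mul, ← hT]
  have b1 := integral_mono im ib pt
  have i7 : Integrable (fun x => 1 + (ψ x - M) ^ 4) γ := (integrable_const 1).add i4
  rw [integral_add (i4.const_mul 2) (i7.const_mul _), integral_const_mul, integral_const_mul,
    integral_add (integrable_const 1) i4] at b1
  simp only [integral_const, probReal_univ, smul_eq_mul, one_mul, mul_one] at b1 ⊢
  have b2 : 4 * n * (1 + ∫ x, (ψ x - M) ^ 4 ∂γ) ≤ 4 * n * (1 + 48 * Real.exp C) := by gcongr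
  nlinarith [sq_nonneg (T - M ^ 2), Real.exp_pos C]

end LipschitzConcentration

/-! ### Quadratic forms in a concentrated isotropic vector -/

/-- The law `γ` has identity second moments. -/
def Isotropic {n : ℕ} (γ : Measure (EuclideanSpace ℝ (Fin n))) : Prop :=
  ∀ i j, ∫ x, x i * x j ∂γ = if i = j then 1 else 0

section QuadraticForm

variable {n : ℕ} {C : ℝ} {γ : Measure (EuclideanSpace ℝ (Fin n))} [IsProbabilityMeasure γ]

theorem lipschitzWith_inner_of_norm_eq_one {u : EuclideanSpace ℝ (Fin n)} (hu : ‖u‖ = 1) :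
    LipschitzWith 1 fun x => inner ℝ u x := by
  refine LipschitzWith.of_dist_le_mul fun x y => ?_
  rw [Real.dist_eq, ← inner_sub_right, dist_eq_norm]
  simpa [hu] using abs_real_inner_le_norm u (x - y)

theorem LipschitzConcentration.integrable_coord_mul (h : LipschitzConcentration C γ)
    (i j : Fin n) : Integrable (fun x => x i * x j) γ := by
  have hl : ∀ i : Fin n, LipschitzWith 1 fun x : EuclideanSpace ℝ (Fin n) => x i := fun i => by
    have := lipschitzWith_inner_of_norm_eq_one (u := EuclideanSpace.single i (1 : ℝ)) (by simp)
    simpa [EuclideanSpace.inner_single_left] using this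
  have hm : ∀ i : Fin n, MemLp (fun x : EuclideanSpace ℝ (Fin n) => x i) 2 γ := fun i =>
    (memLp_two_iff_integrable_sq (by fun_prop)).2 (h.integrable_sq (hl i))
  exact (hm i).integrable_mul (hm j)

theorem Isotropic.integral_inner_sq (hi : Isotropic γ) (h : LipschitzConcentration C γ)
    (u : EuclideanSpace ℝ (Fin n)) : ∫ x, inner ℝ u x ^ 2 ∂γ = ‖u‖ ^ 2 := by
  have e : ∀ x : EuclideanSpace ℝ (Fin n),
      inner ℝ u x ^ 2 = ∑ i, ∑ j, u i * u j * (x i * x j) := fun x => by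
    rw [PiLp.inner_apply, sq, Finset.sum_mul_sum]
    refine Finset.sum_congr rfl fun i _ => Finset.sum_congr rfl fun j _ => ?_
    simp; ring
  simp only [e]
  rw [integral_finsetSum _ fun i _ => integrable_finsetSum _ fun j _ =>
    (h.integrable_coord_mul i j).const_mul _]
  simp_rw [integral_finsetSum _ fun j _ => (h.integrable_coord_mul _ j).const_mul _,
    integral_const_mul, hi _ _]
  rw [EuclideanSpace.norm_sq_eq]
  simp [sq]

variable (b : OrthonormalBasis (Fin n) ℝ (EuclideanSpace ℝ (Fin n)))

theorem LipschitzConcentration.integrable_sum_inner_sq (h : LipschitzConcentration C γ)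
    (α : Fin n → ℂ) :
    Integrable (fun x => ∑ i, α i * ((inner ℝ (b i) x ^ 2 : ℝ) : ℂ)) γ :=
  integrable_finsetSum _ fun i _ =>
    (h.integrable_sq (lipschitzWith_inner_of_norm_eq_one (b.norm_eq_one i))).ofReal.const_mul _

theorem Isotropic.integral_sum_inner_sq (hi : Isotropic γ) (h : LipschitzConcentration C γ)
    (α : Fin n → ℂ) : ∫ x, ∑ i, α i * ((inner ℝ (b i) x ^ 2 : ℝ) : ℂ) ∂γ = ∑ i, α i := by
  rw [integral_finsetSum _ fun i _ => (h.integrable_sq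
    (lipschitzWith_inner_of_norm_eq_one (b.norm_eq_one i))).ofReal.const_mul _]
  refine Finset.sum_congr rfl fun i _ => ?_
  rw [integral_const_mul, integral_complex_ofReal, hi.integral_inner_sq h, b.norm_eq_one]
  simp

/-- A nonnegative quadratic form is the square of a seminorm, hence of a Lipschitz function. -/
theorem Isotropic.variance_form_le_of_nonneg (hn : 1 ≤ n) (hi : Isotropic γ)
    (h : LipschitzConcentration C γ) {α : Fin n → ℝ} (h0 : ∀ i, 0 ≤ α i) (h1 : ∀ i, α i ≤ 1) :
    Integrable (fun x => (∑ i, α i * inner ℝ (b i) x ^ 2 - ∑ i, α i) ^ 2) γ ∧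
    ∫ x, (∑ i, α i * inner ℝ (b i) x ^ 2 - ∑ i, α i) ^ 2 ∂γ ≤ (288 * Real.exp C + 4) * n := by
  set ψ : EuclideanSpace ℝ (Fin n) → ℝ := fun x =>
    ‖(WithLp.toLp 2 fun i => √(α i) * inner ℝ (b i) x : EuclideanSpace ℝ (Fin n))‖ with hψ
  have sq : ∀ x, ψ x ^ 2 = ∑ i, α i * inner ℝ (b i) x ^ 2 := fun x => by
    rw [hψ]; simp only [EuclideanSpace.norm_sq_eq]
    refine Finset.sum_congr rfl fun i _ => ?_
    simp [mul_pow, Real.sq_sqrt (h0 i)]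
  have le : ∀ x, ψ x ≤ ‖x‖ := fun x => by
    refine le_of_sq_le_sq ?_ (norm_nonneg x)
    rw [sq, ← b.sum_sq_norm_inner_right x]
    refine Finset.sum_le_sum fun i _ => ?_
    rw [Real.norm_eq_abs, sq_abs]
    exact mul_le_of_le_one_left (sq_nonneg _) (h1 i)
  have lip : LipschitzWith 1 ψ := by
    refine LipschitzWith.of_dist_le_mul fun x y => ?_
    rw [Real.dist_eq, NNReal.coe_one, one_mul, dist_eq_norm]
    refine (abs_norm_sub_norm_le _ _).trans (le_of_eq_of_le ?_ (le (x - y)))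
    rw [hψ]
    congr 1
    ext i
    simp [inner_sub_right, mul_sub]
  have tot : ∫ x, ψ x ^ 2 ∂γ = ∑ i, α i := by
    have := hi.integral_sum_inner_sq b h fun i => (α i : ℂ)
    have e : ∀ x, (∑ i, (α i : ℂ) * ((inner ℝ (b i) x ^ 2 : ℝ) : ℂ)) = ((ψ x ^ 2 : ℝ) : ℂ) :=
      fun x => by rw [sq]; push_cast; rfl
    simp only [e] at this
    rw [integral_complex_ofReal] at this
    exact_mod_cast this
  have le_n : ∫ x, ψ x ^ 2 ∂γ ≤ n := by
    rw [tot]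
    calc ∑ i, α i ≤ ∑ _i : Fin n, (1 : ℝ) := Finset.sum_le_sum fun i _ => h1 i
      _ = n := by simp
  have := h.variance_sq_le lip (by exact_mod_cast hn) le_n
  rw [tot] at this
  simpa only [sq] using this

theorem Isotropic.variance_form_le_of_norm_le_one (hn : 1 ≤ n) (hi : Isotropic γ)
    (h : LipschitzConcentration C γ) {α : Fin n → ℂ} (h1 : ∀ i, ‖α i‖ ≤ 1) :
    Integrable (fun x =>
      ‖∑ i, α i * ((inner ℝ (b i) x ^ 2 : ℝ) : ℂ) - ∑ i, α i‖ ^ 2) γ ∧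
    ∫ x, ‖∑ i, α i * ((inner ℝ (b i) x ^ 2 : ℝ) : ℂ) - ∑ i, α i‖ ^ 2 ∂γ ≤
      8 * (288 * Real.exp C + 4) * n := by
  -- the positive and negative parts of the real and imaginary parts of the coefficients
  let β : Fin 4 → Fin n → ℝ := ![fun i => max (α i).re 0, fun i => max (-(α i).re) 0,
    fun i => max (α i).im 0, fun i => max (-(α i).im) 0]
  have hre : ∀ i, |(α i).re| ≤ 1 := fun i => (Complex.abs_re_le_norm _).trans (h1 i)
  have him : ∀ i, |(α i).im| ≤ 1 := fun i => (Complex.abs_im_le_norm _).trans (h1 i)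
  have hβ : ∀ k, (∀ i, 0 ≤ β k i) ∧ ∀ i, β k i ≤ 1 := by
    intro k
    fin_cases k
    · exact ⟨fun i => le_max_right _ _, fun i => max_le (abs_le.1 (hre i)).2 zero_le_one⟩
    · exact ⟨fun i => le_max_right _ _,
        fun i => max_le (by linarith [(abs_le.1 (hre i)).1]) zero_le_one⟩
    · exact ⟨fun i => le_max_right _ _, fun i => max_le (abs_le.1 (him i)).2 zero_le_one⟩
    · exact ⟨fun i => le_max_right _ _,
        fun i => max_le (by linarith [(abs_le.1 (him i)).1]) zero_le_one⟩
  let A : Fin 4 → EuclideanSpace ℝ (Fin n) → ℝ := fun k x =>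
    ∑ i, β k i * inner ℝ (b i) x ^ 2 - ∑ i, β k i
  have hA : ∀ k, Integrable (fun x => A k x ^ 2) γ ∧
      ∫ x, A k x ^ 2 ∂γ ≤ (288 * Real.exp C + 4) * n := fun k =>
    hi.variance_form_le_of_nonneg b hn h (hβ k).1 (hβ k).2
  have hmax : ∀ t : ℝ, max t 0 - max (-t) 0 = t := fun t => by
    rcases le_total t 0 with ht | ht
    · rw [max_eq_right ht, max_eq_left (by linarith)]; ring
    · rw [max_eq_left ht, max_eq_right (by linarith)]; ring
  have ere : ∀ x, (∑ i, α i * ((inner ℝ (b i) x ^ 2 : ℝ) : ℂ) - ∑ i, α i).re =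
      A 0 x - A 1 x := fun x => by
    have : ∀ i, (α i).re = β 0 i - β 1 i := fun i => (hmax _).symm
    simp only [A, Complex.sub_re, Complex.re_sum, Complex.re_mul_ofReal, this, sub_mul,
      Finset.sum_sub_distrib]
    ring
  have eim : ∀ x, (∑ i, α i * ((inner ℝ (b i) x ^ 2 : ℝ) : ℂ) - ∑ i, α i).im =
      A 2 x - A 3 x := fun x => by
    have : ∀ i, (α i).im = β 2 i - β 3 i := fun i => (hmax _).symm
    simp only [A, Complex.sub_im, Complex.im_sum, Complex.im_mul_ofReal, this, sub_mul,
      Finset.sum_sub_distrib]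
    ring
  have pt : ∀ x, ‖∑ i, α i * ((inner ℝ (b i) x ^ 2 : ℝ) : ℂ) - ∑ i, α i‖ ^ 2 ≤
      ∑ k, 2 * A k x ^ 2 := fun x => by
    rw [Complex.sq_norm, Complex.normSq_apply, ere, eim, Fin.sum_univ_four]
    nlinarith [sq_nonneg (A 0 x + A 1 x), sq_nonneg (A 2 x + A 3 x)]
  have ib : Integrable (fun x => ∑ k, 2 * A k x ^ 2) γ :=
    integrable_finsetSum _ fun k _ => (hA k).1.const_mul 2
  have im : Integrable (fun x =>
      ‖∑ i, α i * ((inner ℝ (b i) x ^ 2 : ℝ) : ℂ) - ∑ i, α i‖ ^ 2) γ :=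
    ib.mono' (by fun_prop) (.of_forall fun x => by
      rw [Real.norm_of_nonneg (by positivity)]; exact pt x)
  refine ⟨im, (integral_mono im ib pt).trans ?_⟩
  rw [integral_finsetSum _ fun k _ => (hA k).1.const_mul 2]
  simp only [integral_const_mul]
  calc ∑ k, 2 * ∫ x, A k x ^ 2 ∂γ ≤ ∑ _k : Fin 4, 2 * ((288 * Real.exp C + 4) * n) :=
        Finset.sum_le_sum fun k _ => by linarith [(hA k).2]
    _ = _ := by simp; ring

/-- A quadratic form with spectrum bounded by `B` has variance of order `n B²`. -/
theorem Isotropic.variance_form_le (hn : 1 ≤ n) (hi : Isotropic γ)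
    (h : LipschitzConcentration C γ) {B : ℝ} (hB : 0 < B) {α : Fin n → ℂ}
    (h1 : ∀ i, ‖α i‖ ≤ B) :
    Integrable (fun x =>
      ‖∑ i, α i * ((inner ℝ (b i) x ^ 2 : ℝ) : ℂ) - ∑ i, α i‖ ^ 2) γ ∧
    ∫ x, ‖∑ i, α i * ((inner ℝ (b i) x ^ 2 : ℝ) : ℂ) - ∑ i, α i‖ ^ 2 ∂γ ≤
      8 * (288 * Real.exp C + 4) * n * B ^ 2 := by
  have hB' : (B : ℂ) ≠ 0 := by exact_mod_cast hB.ne'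
  obtain ⟨i1, i2⟩ := hi.variance_form_le_of_norm_le_one b hn h (α := fun i => α i / B)
    fun i => by
      rw [norm_div, Complex.norm_real, Real.norm_of_nonneg hB.le, div_le_one hB]; exact h1 i
  have e : ∀ x, ‖∑ i, α i * ((inner ℝ (b i) x ^ 2 : ℝ) : ℂ) - ∑ i, α i‖ ^ 2 =
      B ^ 2 * ‖∑ i, α i / B * ((inner ℝ (b i) x ^ 2 : ℝ) : ℂ) - ∑ i, α i / B‖ ^ 2 := fun x => by
    have : ∑ i, α i * ((inner ℝ (b i) x ^ 2 : ℝ) : ℂ) - ∑ i, α i =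
        B * (∑ i, α i / B * ((inner ℝ (b i) x ^ 2 : ℝ) : ℂ) - ∑ i, α i / B) := by
      rw [mul_sub, Finset.mul_sum, Finset.mul_sum]
      congr 1
      · exact Finset.sum_congr rfl fun i _ => by field_simp
      · exact Finset.sum_congr rfl fun i _ => by field_simp
    rw [this, norm_mul, mul_pow, Complex.norm_real, Real.norm_of_nonneg hB.le]
  simp only [e]
  refine ⟨i1.const_mul _, ?_⟩
  rw [integral_const_mul, mul_comm _ (B ^ 2)]
  gcongr

end QuadraticForm

/-! ### Variance of functions of independent variables -/

theorem integral_norm_sub_const_sq {Ω : Type*} [MeasurableSpace Ω] {P : Measure Ω}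
    [IsProbabilityMeasure P] {g : Ω → ℂ} (hg : AEStronglyMeasurable g P) {B : ℝ}
    (hB : ∀ ω, ‖g ω‖ ≤ B) (c : ℂ) :
    ∫ ω, ‖g ω - c‖ ^ 2 ∂P = ∫ ω, ‖g ω - ∫ η, g η ∂P‖ ^ 2 ∂P + ‖(∫ η, g η ∂P) - c‖ ^ 2 := by
  set M := ∫ η, g η ∂P with hM
  have ig : Integrable g P := .of_bound hg B (.of_forall hB)
  have e : ∀ ω, ‖g ω - c‖ ^ 2 =
      ‖g ω - M‖ ^ 2 + ‖M - c‖ ^ 2 + 2 * ((g ω - M) * (starRingEnd ℂ) (M - c)).re := fun ω => by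
    simp only [Complex.sq_norm, Complex.normSq_apply, Complex.mul_re, Complex.sub_re,
      Complex.sub_im, Complex.conj_re, Complex.conj_im]
    ring
  have i1 : Integrable (fun ω => ‖g ω - M‖ ^ 2) P := by
    refine .of_bound (by fun_prop) ((B + ‖M‖) ^ 2) (.of_forall fun ω => ?_)
    rw [Real.norm_of_nonneg (by positivity)]
    gcongr
    exact (norm_sub_le _ _).trans (by gcongr; exact hB ω)
  have i2 : Integrable (fun ω => (g ω - M) * (starRingEnd ℂ) (M - c)) P :=
    (ig.sub (integrable_const M)).mul_const _
  have i3 : Integrable (fun ω => ‖g ω - M‖ ^ 2 + ‖M - c‖ ^ 2) P := i1.add (integrable_const _)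
  have i4 : Integrable (fun ω => 2 * ((g ω - M) * (starRingEnd ℂ) (M - c)).re) P :=
    i2.re.const_mul 2
  simp only [e]
  rw [integral_add i3 i4, integral_add i1 (integrable_const _), integral_const_mul]
  have : ∫ ω, ((g ω - M) * (starRingEnd ℂ) (M - c)).re ∂P = 0 := by
    have h := integral_re i2
    simp only [RCLike.re_eq_complex_re] at h
    rw [h, integral_mul_const, integral_sub ig (integrable_const M)]
    simp [hM]
  rw [this]
  simp

/-- The bounded difference inequality for the variance. -/
theorem integral_norm_sub_integral_sq_le_of_bounded_difference {A : Type*} [MeasurableSpace A]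
    {γ : Measure A} [IsProbabilityMeasure γ] {D B : ℝ} {m : ℕ} {f : (Fin m → A) → ℂ}
    (hf : Measurable f) (hB : ∀ x, ‖f x‖ ≤ B)
    (hD : ∀ x j a, ‖f (Function.update x j a) - f x‖ ≤ D) :
    ∫ x, ‖f x - ∫ y, f y ∂(Measure.pi fun _ => γ)‖ ^ 2 ∂(Measure.pi fun _ => γ) ≤ m * D ^ 2 := by
  induction m with
  | zero =>
    have : ∀ x, f x - ∫ y, f y ∂(Measure.pi fun _ => γ) = 0 := fun x => by
      rw [funext fun y => congrArg f (Subsingleton.elim y x)]; simp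
    simp [this]
  | succ m ih =>
    set e := (MeasurableEquiv.piFinSuccAbove (fun _ : Fin (m + 1) => A) 0).symm with he
    have hmp : MeasurePreserving e (γ.prod (Measure.pi fun _ : Fin m => γ))
        (Measure.pi fun _ => γ) :=
      (measurePreserving_piFinSuccAbove (fun _ : Fin (m + 1) => γ) 0).symm
    have he' : ∀ p, e p = Fin.cons p.1 p.2 := fun p => by
      simp [e, MeasurableEquiv.piFinSuccAbove, Fin.consEquiv]
    have hFm : Measurable fun p : A × (Fin m → A) => f (Fin.cons p.1 p.2) := by
      simp only [← he']; exact hf.comp e.measurable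
    have hFm' : ∀ b : Fin m → A, Measurable fun a => f (Fin.cons a b) := fun b =>
      hFm.comp (measurable_id.prodMk measurable_const)
    have iF : ∀ b : Fin m → A, Integrable (fun a => f (Fin.cons a b)) γ := fun b =>
      .of_bound (hFm' b).aestronglyMeasurable B (.of_forall fun a => hB _)
    set h : (Fin m → A) → ℂ := fun b => ∫ a, f (Fin.cons a b) ∂γ with hh
    have hhm : Measurable h :=
      (hFm.stronglyMeasurable.integral_prod_left').measurable
    have bd : ∀ u : A → ℂ, (Measurable u) → ∀ r, (∀ a, ‖u a‖ ≤ r) → ‖∫ a, u a ∂γ‖ ≤ r := by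
      intro u hu r hr
      simpa using norm_integral_le_of_norm_le_const (μ := γ) (.of_forall hr)
    have hhB : ∀ b, ‖h b‖ ≤ B := fun b => bd _ (hFm' b) B fun a => hB _
    have hhD : ∀ b j a, ‖h (Function.update b j a) - h b‖ ≤ D := fun b j a => by
      rw [hh]; simp only
      rw [← integral_sub (iF _) (iF _)]
      refine bd _ ((hFm' _).sub (hFm' _)) D fun a' => ?_
      have := hD (Fin.cons a' b) j.succ a
      rwa [← Fin.cons_update] at this
    have hFh : ∀ a b, ‖f (Fin.cons a b) - h b‖ ≤ D := fun a b => by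
      have : f (Fin.cons a b) - h b = ∫ a', (f (Fin.cons a b) - f (Fin.cons a' b)) ∂γ := by
        rw [integral_sub (integrable_const _) (iF b)]; simp [hh]
      rw [this]
      refine bd _ (measurable_const.sub (hFm' b)) D fun a' => ?_
      have := hD (Fin.cons a' b) 0 a
      rwa [Fin.update_cons_zero] at this
    have hD0 : 0 ≤ D := by
      have : Nonempty A := by
        by_contra hA
        rw [not_nonempty_iff] at hA
        exact IsProbabilityMeasure.ne_zero γ (Measure.eq_zero_of_isEmpty γ)
      obtain ⟨a⟩ := this
      exact (norm_nonneg _).trans (hD (fun _ => a) 0 a)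
    set π := Measure.pi fun _ : Fin m => γ with hπ
    have mean : ∫ y, f y ∂(Measure.pi fun _ : Fin (m + 1) => γ) = ∫ b, h b ∂π := by
      rw [← hmp.integral_comp e.measurableEmbedding]
      simp only [he']
      rw [integral_prod_symm _ (.of_bound hFm.aestronglyMeasurable B (.of_forall fun a => hB _))]
    rw [mean]
    set c := ∫ b, h b ∂π with hc
    have hcB : ‖c‖ ≤ B := by
      simpa using norm_integral_le_of_norm_le_const (μ := π) (.of_forall hhB)
    rw [← hmp.integral_comp e.measurableEmbedding]
    simp only [he']
    have bound2 : ∀ u : ℂ, ‖u‖ ≤ B → ‖‖u - c‖ ^ 2‖ ≤ (B + B) ^ 2 := fun u hu => by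
      rw [Real.norm_of_nonneg (by positivity)]
      gcongr
      exact (norm_sub_le _ _).trans (add_le_add hu hcB)
    rw [integral_prod_symm _ (.of_bound
      ((hFm.sub_const c).norm.pow_const 2).aestronglyMeasurable ((B + B) ^ 2)
      (.of_forall fun a => bound2 _ (hB _)))]
    have inner : ∀ b, ∫ a, ‖f (Fin.cons a b) - c‖ ^ 2 ∂γ ≤ D ^ 2 + ‖h b - c‖ ^ 2 := fun b => by
      rw [integral_norm_sub_const_sq (hFm' b).aestronglyMeasurable (fun a => hB _) c]
      gcongr
      have : ∀ a, ‖f (Fin.cons a b) - h b‖ ^ 2 ≤ D ^ 2 := fun a => by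
        gcongr; exact hFh a b
      refine (integral_mono_of_nonneg (.of_forall fun a => by positivity)
        (integrable_const (D ^ 2)) (.of_forall this)).trans ?_
      simp
    have i1 : Integrable (fun b => ‖h b - c‖ ^ 2) π :=
      .of_bound (by fun_prop) ((B + B) ^ 2) (.of_forall fun b => bound2 _ (hhB b))
    calc _ ≤ ∫ b, (D ^ 2 + ‖h b - c‖ ^ 2) ∂π :=
          integral_mono_of_nonneg (.of_forall fun b => integral_nonneg fun a => by positivity)
            ((integrable_const _).add i1) (.of_forall inner)
      _ = D ^ 2 + ∫ b, ‖h b - c‖ ^ 2 ∂π := by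
          rw [integral_add (integrable_const _) i1]; simp
      _ ≤ D ^ 2 + m * D ^ 2 := by gcongr; exact ih hhm hhB hhD
      _ = _ := by push_cast; ring

/-- Replacing one coordinate by an independent copy does not change a product law. -/
theorem measurePreserving_update {A ι : Type*} [Fintype ι] [DecidableEq ι] [MeasurableSpace A]
    (γ : Measure A) [IsProbabilityMeasure γ] (j : ι) :
    MeasurePreserving (fun p : (ι → A) × A => Function.update p.1 j p.2)
      ((Measure.pi fun _ => γ).prod γ) (Measure.pi fun _ => γ) := by
  have hm : Measurable fun p : (ι → A) × A => Function.update p.1 j p.2 := by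
    refine measurable_pi_iff.2 fun i => ?_
    rcases eq_or_ne i j with rfl | hij
    · simpa using measurable_snd
    · simp only [Function.update_of_ne hij]
      exact (measurable_pi_apply i).comp measurable_fst
  refine ⟨hm, (Measure.pi_eq fun s hs => ?_).symm⟩
  rw [Measure.map_apply hm (.univ_pi hs)]
  have : (fun p : (ι → A) × A => Function.update p.1 j p.2) ⁻¹' Set.univ.pi s =
      Set.univ.pi (Function.update s j Set.univ) ×ˢ s j := by
    ext ⟨x, y⟩
    simp only [Set.mem_preimage, Set.mem_pi, Set.mem_univ, true_imp_iff, Set.mem_prod]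
    constructor
    · refine fun h => ⟨fun i => ?_, by simpa using h j⟩
      rcases eq_or_ne i j with rfl | hij
      · simp
      · simpa [Function.update_of_ne hij] using h i
    · rintro ⟨h1, h2⟩ i
      rcases eq_or_ne i j with rfl | hij
      · simpa using h2
      · simpa [Function.update_of_ne hij] using h1 i
  rw [this, Measure.prod_prod, Measure.pi_pi, ← Finset.mul_prod_erase _ _ (Finset.mem_univ j),
    ← Finset.mul_prod_erase _ (fun i => γ (s i)) (Finset.mem_univ j)]
  simp only [Function.update_self, measure_univ, one_mul]
  rw [mul_comm]
  congr 1
  refine Finset.prod_congr rfl fun i hi => ?_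
  rw [Function.update_of_ne (Finset.ne_of_mem_erase hi)]

/-! ### Resolvents of real symmetric matrices -/

namespace Matrix

open scoped Matrix

variable {ι : Type*} [Fintype ι] [DecidableEq ι]

/-- The complex matrix `H - w`. -/
def shift (H : Matrix ι ι ℝ) (w : ℂ) : Matrix ι ι ℂ := H.map Complex.ofRealHom - w • 1

/-- The resolvent `(H - w)⁻¹`. It is used only where `w` is not an eigenvalue of `H`. -/
def resolvent (H : Matrix ι ι ℝ) (w : ℂ) : Matrix ι ι ℂ := (H.shift w)⁻¹

namespace IsHermitian

variable {H : Matrix ι ι ℝ} (hH : H.IsHermitian)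

/-- The orthogonal matrix of eigenvectors, with complex entries. -/
def complexEigenvectors : Matrix ι ι ℂ :=
  (hH.eigenvectorUnitary : Matrix ι ι ℝ).map Complex.ofRealHom

/-- The matrix with the eigenvectors of `H` and the eigenvalues `g`. -/
def spectralMatrix (g : ι → ℂ) : Matrix ι ι ℂ :=
  hH.complexEigenvectors * diagonal g * hH.complexEigenvectorsᵀ

theorem transpose_mul_complexEigenvectors :
    hH.complexEigenvectorsᵀ * hH.complexEigenvectors = 1 := by
  have h : (hH.eigenvectorUnitary : Matrix ι ι ℝ)ᵀ *
      (hH.eigenvectorUnitary : Matrix ι ι ℝ) = 1 := by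
    have := Unitary.coe_star_mul_self hH.eigenvectorUnitary
    rwa [star_eq_conjTranspose, conjTranspose_eq_transpose_of_trivial] at this
  rw [complexEigenvectors, ← transpose_map, ← Matrix.map_mul, h]
  exact Matrix.map_one _ (map_zero _) (map_one _)

theorem complexEigenvectors_mul_transpose :
    hH.complexEigenvectors * hH.complexEigenvectorsᵀ = 1 :=
  mul_eq_one_comm.1 hH.transpose_mul_complexEigenvectors

theorem spectralMatrix_mul (g g' : ι → ℂ) :
    hH.spectralMatrix g * hH.spectralMatrix g' = hH.spectralMatrix (g * g') := by
  calc hH.spectralMatrix g * hH.spectralMatrix g'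
      = hH.complexEigenvectors * diagonal g *
        (hH.complexEigenvectorsᵀ * hH.complexEigenvectors) * diagonal g' *
          hH.complexEigenvectorsᵀ := by simp only [spectralMatrix, Matrix.mul_assoc]
    _ = _ := by
      rw [hH.transpose_mul_complexEigenvectors, Matrix.mul_one, Matrix.mul_assoc _ (diagonal g),
        diagonal_mul_diagonal]
      rfl

theorem spectralMatrix_one : hH.spectralMatrix 1 = 1 := by
  rw [spectralMatrix, Pi.one_def, diagonal_one, Matrix.mul_one, complexEigenvectors_mul_transpose]

theorem shift_eq_spectralMatrix (w : ℂ) :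
    H.shift w = hH.spectralMatrix fun i => (hH.eigenvalues i : ℂ) - w := by
  have h1 : H.map Complex.ofRealHom = hH.spectralMatrix fun i => (hH.eigenvalues i : ℂ) := by
    conv_lhs => rw [hH.spectral_theorem]
    rw [Unitary.conjStarAlgAut_apply, Matrix.map_mul, Matrix.map_mul, star_eq_conjTranspose,
      conjTranspose_eq_transpose_of_trivial, spectralMatrix, complexEigenvectors, transpose_map]
    congr 2
    rw [diagonal_map (map_zero _)]
    rfl
  have h2 : w • (1 : Matrix ι ι ℂ) = hH.spectralMatrix fun _ => w := by
    rw [← hH.complexEigenvectors_mul_transpose, spectralMatrix, ← smul_one_eq_diagonal]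
    simp
  rw [shift, h1, h2, spectralMatrix, spectralMatrix, spectralMatrix, ← Matrix.sub_mul,
    ← Matrix.mul_sub, diagonal_sub]

theorem shift_mul_resolvent {w : ℂ} (hw : ∀ i, (hH.eigenvalues i : ℂ) ≠ w) :
    H.shift w * H.resolvent w = 1 ∧
      H.resolvent w = hH.spectralMatrix fun i => ((hH.eigenvalues i : ℂ) - w)⁻¹ := by
  have h : H.shift w * (hH.spectralMatrix fun i => ((hH.eigenvalues i : ℂ) - w)⁻¹) = 1 := by
    rw [hH.shift_eq_spectralMatrix, spectralMatrix_mul, ← hH.spectralMatrix_one]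
    congr 1
    ext i
    simp [sub_ne_zero.2 (hw i)]
  have h' : H.resolvent w = _ := inv_eq_right_inv h
  exact ⟨by rw [h', h], h'⟩

theorem trace_spectralMatrix (g : ι → ℂ) : (hH.spectralMatrix g).trace = ∑ i, g i := by
  rw [spectralMatrix, trace_mul_comm, ← Matrix.mul_assoc, hH.transpose_mul_complexEigenvectors,
    Matrix.one_mul, trace_diagonal]

theorem dotProduct_spectralMatrix_mulVec (g : ι → ℂ) (y : EuclideanSpace ℝ ι) :
    (fun i => (y i : ℂ)) ⬝ᵥ hH.spectralMatrix g *ᵥ (fun i => (y i : ℂ)) =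
      ∑ i, g i * ((inner ℝ (hH.eigenvectorBasis i) y ^ 2 : ℝ) : ℂ) := by
  have h : hH.complexEigenvectorsᵀ *ᵥ (fun i => (y i : ℂ)) =
      fun i => ((inner ℝ (hH.eigenvectorBasis i) y : ℝ) : ℂ) := by
    ext i
    rw [PiLp.inner_apply]
    simp [mulVec, dotProduct, complexEigenvectors, mul_comm]
  rw [spectralMatrix, ← mulVec_mulVec, ← mulVec_mulVec, h, dotProduct_mulVec,
    ← mulVec_transpose, h]
  simp only [dotProduct, mulVec_diagonal]
  refine Finset.sum_congr rfl fun i _ => ?_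
  push_cast; ring

end IsHermitian

/-- The Sherman–Morrison identity for a symmetric rank-one perturbation. -/
theorem shermanMorrison_mulVec {A R R' : Matrix ι ι ℂ} {y : ι → ℂ} (h : A * R = 1)
    (h' : R' * (A + vecMulVec y y) = 1) :
    (1 + y ⬝ᵥ R *ᵥ y) • (R' *ᵥ y) = R *ᵥ y ∧ R - R' = vecMulVec (R' *ᵥ y) (y ᵥ* R) := by
  have e : R = R' + vecMulVec (R' *ᵥ y) (y ᵥ* R) := by
    calc R = R' * (A + vecMulVec y y) * R := by rw [h', Matrix.one_mul]
      _ = R' * (A * R) + R' * vecMulVec y y * R := by noncomm_ring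
      _ = _ := by rw [h, Matrix.mul_one, mul_vecMulVec, vecMulVec_mul]
  refine ⟨?_, by rw [sub_eq_iff_eq_add']; exact e⟩
  conv_rhs => rw [e]
  rw [add_mulVec, vecMulVec_mulVec, add_smul, one_smul, dotProduct_mulVec]
  simp

theorem shermanMorrison_dotProduct {A R R' : Matrix ι ι ℂ} {y : ι → ℂ} (h : A * R = 1)
    (h' : R' * (A + vecMulVec y y) = 1) :
    (1 + y ⬝ᵥ R *ᵥ y) * (y ⬝ᵥ R' *ᵥ y) = y ⬝ᵥ R *ᵥ y := by
  conv_rhs => rw [← (shermanMorrison_mulVec h h').1]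
  rw [dotProduct_smul, smul_eq_mul]

theorem shermanMorrison_trace {A R R' : Matrix ι ι ℂ} {y : ι → ℂ} (h : A * R = 1)
    (h' : R' * (A + vecMulVec y y) = 1) :
    (1 + y ⬝ᵥ R *ᵥ y) * (R.trace - R'.trace) = y ⬝ᵥ (R * R) *ᵥ y := by
  obtain ⟨h1, h2⟩ := shermanMorrison_mulVec h h'
  rw [← trace_sub, h2, trace_vecMulVec, ← smul_eq_mul, ← smul_dotProduct, h1, dotProduct_comm,
    ← dotProduct_mulVec, mulVec_mulVec]

theorem continuous_resolvent {X : Type*} [TopologicalSpace X] {H : X → Matrix ι ι ℝ}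
    (hc : Continuous H) {w : ℂ} (hw : ∀ x, (H x).shift w * (H x).resolvent w = 1) :
    Continuous fun x => (H x).resolvent w := by
  have h1 : Continuous fun x => (H x).shift w :=
    (hc.matrix_map Complex.continuous_ofReal).sub continuous_const
  have h2 : ∀ x, ((H x).shift w).det ≠ 0 := fun x h0 => by
    have := congrArg det (hw x)
    rw [det_mul, h0, zero_mul, det_one] at this
    exact zero_ne_one this
  simp only [resolvent, inv_def, Ring.inverse_eq_inv']
  exact (h1.matrix_det.inv₀ h2).smul h1.matrix_adjugate

end Matrix

/-! ### Resolvents of positive semidefinite matrices at a square -/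

section Scalar

variable {z : ℂ} {t : ℝ}

theorem Complex.ofReal_sub_sq_ne_zero (hz : 0 < z.im) (ht : 0 ≤ t) : (t : ℂ) - z ^ 2 ≠ 0 := by
  intro h
  have h1 := congrArg Complex.re h
  have h2 := congrArg Complex.im h
  simp [sq] at h1 h2
  have h3 : z.re = 0 := by
    have : z.re * z.im = 0 := by linarith
    exact (mul_eq_zero.1 this).resolve_right hz.ne'
  rw [h3] at h1
  nlinarith

theorem Complex.normSq_ofReal_sub_sq :
    Complex.normSq ((t : ℂ) - z ^ 2) = (t - z.re ^ 2 + z.im ^ 2) ^ 2 + 4 * z.re ^ 2 * z.im ^ 2 := by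
  simp [Complex.normSq_apply, sq]
  ring

theorem norm_div_ofReal_sub_sq_le (hz : 0 < z.im) (ht : 0 ≤ t) :
    ‖z / ((t : ℂ) - z ^ 2)‖ ≤ 1 / z.im := by
  have h0 := Complex.ofReal_sub_sq_ne_zero hz ht
  rw [norm_div, div_le_div_iff₀ (norm_pos_iff.2 h0) hz, one_mul]
  refine le_of_sq_le_sq ?_ (norm_nonneg _)
  rw [mul_pow, Complex.sq_norm, Complex.sq_norm, Complex.normSq_ofReal_sub_sq,
    Complex.normSq_apply]
  rcases le_total (z.im ^ 2) (z.re ^ 2) with h | h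
  · nlinarith [sq_nonneg (t - z.re ^ 2 + z.im ^ 2), mul_nonneg (sub_nonneg.2 h) (sq_nonneg z.im),
      mul_nonneg (sq_nonneg z.re) (sq_nonneg z.im)]
  · nlinarith [mul_nonneg ht (sub_nonneg.2 h), mul_nonneg (sq_nonneg z.re) (sq_nonneg z.im),
      mul_nonneg (sq_nonneg z.re) (sq_nonneg z.re), sq_nonneg t]

theorem im_div_ofReal_sub_sq : (z / ((t : ℂ) - z ^ 2)).im =
    z.im * (t + ‖z‖ ^ 2) / ‖(t : ℂ) - z ^ 2‖ ^ 2 := by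
  rw [Complex.div_im, Complex.sq_norm, Complex.sq_norm, ← sub_div]
  congr 1
  simp [Complex.normSq_apply, sq]
  ring

theorem norm_sq_div_sq_le_im (hz : 0 < z.im) (ht : 0 ≤ t) :
    ‖z ^ 2 * (((t : ℂ) - z ^ 2)⁻¹ * ((t : ℂ) - z ^ 2)⁻¹)‖ * z.im ≤
      (z / ((t : ℂ) - z ^ 2)).im := by
  rw [im_div_ofReal_sub_sq, norm_mul, norm_mul, norm_inv, norm_pow, ← sq, inv_pow,
    ← div_eq_mul_inv, div_mul_eq_mul_div]
  refine div_le_div_of_nonneg_right ?_ (sq_nonneg _)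
  nlinarith [mul_nonneg hz.le ht]

end Scalar

namespace Matrix.PosSemidef

open scoped Matrix

variable {ι : Type*} [Fintype ι] [DecidableEq ι] {H : Matrix ι ι ℝ} {z : ℂ}

theorem eigenvalues_ne_sq (hH : H.PosSemidef) (hz : 0 < z.im) (i : ι) :
    (hH.1.eigenvalues i : ℂ) ≠ z ^ 2 :=
  sub_ne_zero.1 (Complex.ofReal_sub_sq_ne_zero hz (hH.eigenvalues_nonneg i))

theorem trace_resolvent_sq (hH : H.PosSemidef) (hz : 0 < z.im) :
    z * (H.resolvent (z ^ 2)).trace = ∑ i, z / ((hH.1.eigenvalues i : ℂ) - z ^ 2) := by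
  rw [(hH.1.shift_mul_resolvent (hH.eigenvalues_ne_sq hz)).2, hH.1.trace_spectralMatrix,
    Finset.mul_sum]
  rfl

theorem dotProduct_resolvent_sq (hH : H.PosSemidef) (hz : 0 < z.im) (y : EuclideanSpace ℝ ι) :
    z * ((fun i => (y i : ℂ)) ⬝ᵥ H.resolvent (z ^ 2) *ᵥ (fun i => (y i : ℂ))) =
      ∑ i, z / ((hH.1.eigenvalues i : ℂ) - z ^ 2) *
        ((inner ℝ (hH.1.eigenvectorBasis i) y ^ 2 : ℝ) : ℂ) := by
  rw [(hH.1.shift_mul_resolvent (hH.eigenvalues_ne_sq hz)).2,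
    hH.1.dotProduct_spectralMatrix_mulVec, Finset.mul_sum]
  exact Finset.sum_congr rfl fun i _ => by rw [div_eq_mul_inv]; ring

theorem norm_trace_resolvent_sq_le (hH : H.PosSemidef) (hz : 0 < z.im) :
    ‖z * (H.resolvent (z ^ 2)).trace‖ ≤ Fintype.card ι * (1 / z.im) := by
  rw [hH.trace_resolvent_sq hz]
  refine (norm_sum_le_of_le _ fun i _ =>
    norm_div_ofReal_sub_sq_le hz (hH.eigenvalues_nonneg i)).trans ?_
  simp

theorem im_trace_resolvent_sq_nonneg (hH : H.PosSemidef) (hz : 0 < z.im) :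
    0 ≤ (z * (H.resolvent (z ^ 2)).trace).im := by
  rw [hH.trace_resolvent_sq hz, Complex.im_sum]
  refine Finset.sum_nonneg fun i _ => ?_
  rw [im_div_ofReal_sub_sq]
  have := hH.eigenvalues_nonneg i
  positivity

theorem im_dotProduct_resolvent_sq_nonneg (hH : H.PosSemidef) (hz : 0 < z.im)
    (y : EuclideanSpace ℝ ι) :
    0 ≤ (z * ((fun i => (y i : ℂ)) ⬝ᵥ H.resolvent (z ^ 2) *ᵥ (fun i => (y i : ℂ)))).im := by
  rw [hH.dotProduct_resolvent_sq hz, Complex.im_sum]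
  refine Finset.sum_nonneg fun i _ => ?_
  rw [Complex.im_mul_ofReal, im_div_ofReal_sub_sq]
  have := hH.eigenvalues_nonneg i
  positivity

/-- A rank-one perturbation changes the trace of the resolvent by a bounded amount. -/
theorem norm_trace_resolvent_sub_le (hH : H.PosSemidef) (hz : 0 < z.im) (y : EuclideanSpace ℝ ι)
    (hH' : (H + vecMulVec y y).PosSemidef) :
    ‖z * (H.resolvent (z ^ 2)).trace - z * ((H + vecMulVec y y).resolvent (z ^ 2)).trace‖ ≤
      1 / z.im := by
  set yc : ι → ℂ := fun i => (y i : ℂ) with hyc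
  set R := H.resolvent (z ^ 2) with hR
  set R' := (H + vecMulVec y y).resolvent (z ^ 2) with hR'
  obtain ⟨h1, h2⟩ := hH.1.shift_mul_resolvent (hH.eigenvalues_ne_sq hz)
  have h3 : R' * (H.shift (z ^ 2) + vecMulVec yc yc) = 1 := by
    have := mul_eq_one_comm.1 (hH'.1.shift_mul_resolvent (hH'.eigenvalues_ne_sq hz)).1
    rw [← hR'] at this
    rw [← this]
    congr 1
    ext i j
    simp [shift, vecMulVec, hyc]
    ring
  have key := shermanMorrison_trace h1 h3
  rw [← hR] at key
  have him : ((z + z * (yc ⬝ᵥ R *ᵥ yc)).im) = z.im + ∑ i,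
      (z / ((hH.1.eigenvalues i : ℂ) - z ^ 2)).im * inner ℝ (hH.1.eigenvectorBasis i) y ^ 2 := by
    rw [Complex.add_im, hR, hyc, hH.dotProduct_resolvent_sq hz, Complex.im_sum]
    simp only [Complex.im_mul_ofReal]
  have hnum : ‖z ^ 2 * (yc ⬝ᵥ (R * R) *ᵥ yc)‖ * z.im ≤ (z + z * (yc ⬝ᵥ R *ᵥ yc)).im := by
    rw [him, hR, h2, hH.1.spectralMatrix_mul, hyc, hH.1.dotProduct_spectralMatrix_mulVec,
      Finset.mul_sum]
    calc _ ≤ (∑ i, ‖z ^ 2 * (((hH.1.eigenvalues i : ℂ) - z ^ 2)⁻¹ *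
              ((hH.1.eigenvalues i : ℂ) - z ^ 2)⁻¹)‖ *
              inner ℝ (hH.1.eigenvectorBasis i) y ^ 2) * z.im := by
          gcongr
          refine norm_sum_le_of_le _ fun i _ => ?_
          rw [← mul_assoc, norm_mul, Complex.norm_real, Real.norm_of_nonneg (sq_nonneg _)]
          rfl
      _ = ∑ i, (‖z ^ 2 * (((hH.1.eigenvalues i : ℂ) - z ^ 2)⁻¹ *
              ((hH.1.eigenvalues i : ℂ) - z ^ 2)⁻¹)‖ * z.im) *
              inner ℝ (hH.1.eigenvectorBasis i) y ^ 2 := by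
          rw [Finset.sum_mul]; exact Finset.sum_congr rfl fun i _ => by ring
      _ ≤ _ := by
          refine (Finset.sum_le_sum fun i _ => ?_).trans (le_add_of_nonneg_left hz.le)
          gcongr
          exact norm_sq_div_sq_le_im hz (hH.eigenvalues_nonneg i)
  have hpos : 0 < (z + z * (yc ⬝ᵥ R *ᵥ yc)).im := by
    rw [Complex.add_im]
    exact add_pos_of_pos_of_nonneg hz (hH.im_dotProduct_resolvent_sq_nonneg hz y)
  have hq : (z + z * (yc ⬝ᵥ R *ᵥ yc)).im ≤ ‖z + z * (yc ⬝ᵥ R *ᵥ yc)‖ :=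
    (le_abs_self _).trans (Complex.abs_im_le_norm _)
  have e : (z + z * (yc ⬝ᵥ R *ᵥ yc)) * (z * R.trace - z * R'.trace) =
      z ^ 2 * (yc ⬝ᵥ (R * R) *ᵥ yc) := by rw [← key]; ring
  rw [le_div_iff₀ hz]
  have e2 := congrArg norm e
  rw [norm_mul] at e2
  rw [← e2] at hnum
  have hp := hpos.trans_le hq
  have : ‖z + z * (yc ⬝ᵥ R *ᵥ yc)‖ * (‖z * R.trace - z * R'.trace‖ * z.im) ≤
      ‖z + z * (yc ⬝ᵥ R *ᵥ yc)‖ * 1 := by linarith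
  exact le_of_mul_le_mul_left this hp

end Matrix.PosSemidef

/-! ### Removing a column -/

namespace Wishart

open Matrix

section Gram

variable {n m : ℕ}

/-- The `j`-th column `X j / √n`. -/
def col (x : Fin m → EuclideanSpace ℝ (Fin n)) (j : Fin m) : EuclideanSpace ℝ (Fin n) :=
  (√(n : ℝ))⁻¹ • x j

/-- The sum of the rank-one matrices of the columns with index in `S`. For `S = Finset.univ` this
is `Y Y*`. -/
def gram (S : Finset (Fin m)) (x : Fin m → EuclideanSpace ℝ (Fin n)) :
    Matrix (Fin n) (Fin n) ℝ :=
  ∑ j ∈ S, vecMulVec (col x j).ofLp (col x j).ofLp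

theorem gram_posSemidef (S : Finset (Fin m)) (x : Fin m → EuclideanSpace ℝ (Fin n)) :
    (gram S x).PosSemidef :=
  posSemidef_sum _ fun j _ => by
    simpa using posSemidef_vecMulVec_self_star (col x j).ofLp

theorem continuous_col (j : Fin m) :
    Continuous fun x : Fin m → EuclideanSpace ℝ (Fin n) => col x j := by
  unfold col; fun_prop

theorem continuous_gram (S : Finset (Fin m)) :
    Continuous (gram S : (Fin m → EuclideanSpace ℝ (Fin n)) → _) := by
  refine continuous_finsetSum _ fun j _ => ?_
  have := (PiLp.continuous_ofLp 2 _).comp (continuous_col (n := n) j)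
  exact this.matrix_vecMulVec this

theorem gram_univ (x : Fin m → EuclideanSpace ℝ (Fin n)) (j : Fin m) :
    gram Finset.univ x =
      gram (Finset.univ.erase j) x + vecMulVec (col x j).ofLp (col x j).ofLp :=
  (Finset.sum_erase_add _ _ (Finset.mem_univ j)).symm

theorem gram_update {S : Finset (Fin m)} {j : Fin m} (hj : j ∉ S)
    (x : Fin m → EuclideanSpace ℝ (Fin n)) (a : EuclideanSpace ℝ (Fin n)) :
    gram S (Function.update x j a) = gram S x :=
  Finset.sum_congr rfl fun i hi => by
    have : i ≠ j := fun h => hj (h ▸ hi)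
    simp [col, Function.update_of_ne this]

/-- The normalized trace `(1/n) tr (z (Y Y* - z²)⁻¹)` of the `n × n` block of the resolvent of
`W`, formed with the columns in `S` only. -/
def blockTrace (S : Finset (Fin m)) (z : ℂ) (x : Fin m → EuclideanSpace ℝ (Fin n)) : ℂ :=
  z * ((gram S x).resolvent (z ^ 2)).trace / n

/-- The quadratic form of the `j`-th column in the `n × n` block of the resolvent formed with
all other columns. -/
def columnForm (j : Fin m) (z : ℂ) (x : Fin m → EuclideanSpace ℝ (Fin n)) : ℂ :=
  z * ((fun i => (col x j i : ℂ)) ⬝ᵥ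
    (gram (Finset.univ.erase j) x).resolvent (z ^ 2) *ᵥ (fun i => (col x j i : ℂ)))

variable {z : ℂ} (S : Finset (Fin m)) (j : Fin m) (x : Fin m → EuclideanSpace ℝ (Fin n))

theorem continuous_resolvent_gram (hz : 0 < z.im) :
    Continuous fun x : Fin m → EuclideanSpace ℝ (Fin n) => (gram S x).resolvent (z ^ 2) :=
  continuous_resolvent (continuous_gram S) fun x =>
    ((gram_posSemidef S x).1.shift_mul_resolvent
      ((gram_posSemidef S x).eigenvalues_ne_sq hz)).1

theorem continuous_blockTrace (hz : 0 < z.im) :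
    Continuous (blockTrace S z : (Fin m → EuclideanSpace ℝ (Fin n)) → ℂ) :=
  (continuous_const.mul (continuous_resolvent_gram S hz).matrix_trace).div_const _

theorem continuous_columnForm (hz : 0 < z.im) :
    Continuous (columnForm j z : (Fin m → EuclideanSpace ℝ (Fin n)) → ℂ) := by
  have h : Continuous fun x : Fin m → EuclideanSpace ℝ (Fin n) =>
      fun i => (col x j i : ℂ) :=
    continuous_pi fun i => Complex.continuous_ofReal.comp
      ((EuclideanSpace.proj i).continuous.comp (continuous_col j))
  exact continuous_const.mul (h.dotProduct ((continuous_resolvent_gram _ hz).matrix_mulVec h))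

theorem norm_blockTrace_le (hz : 0 < z.im) : ‖blockTrace S z x‖ ≤ 1 / z.im := by
  rw [blockTrace, norm_div, Complex.norm_natCast]
  refine div_le_of_le_mul₀ (by positivity) (by positivity) ?_
  have := (gram_posSemidef S x).norm_trace_resolvent_sq_le hz
  rw [Fintype.card_fin] at this
  linarith

theorem im_blockTrace_nonneg (hz : 0 < z.im) : 0 ≤ (blockTrace S z x).im := by
  rw [blockTrace, Complex.div_natCast_im]
  exact div_nonneg ((gram_posSemidef S x).im_trace_resolvent_sq_nonneg hz) (Nat.cast_nonneg n)

theorem im_columnForm_nonneg (hz : 0 < z.im) : 0 ≤ (columnForm j z x).im :=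
  (gram_posSemidef _ x).im_dotProduct_resolvent_sq_nonneg hz _

theorem norm_blockTrace_erase_sub_le (hz : 0 < z.im) :
    ‖blockTrace (Finset.univ.erase j) z x - blockTrace Finset.univ z x‖ ≤ 1 / (n * z.im) := by
  have h := (gram_posSemidef (Finset.univ.erase j) x).norm_trace_resolvent_sub_le hz (col x j)
    (by rw [← gram_univ]; exact gram_posSemidef _ x)
  rw [← gram_univ] at h
  rw [blockTrace, blockTrace, ← sub_div, norm_div, Complex.norm_natCast, mul_comm (n : ℝ),
    ← div_div]
  exact div_le_div_of_nonneg_right h (Nat.cast_nonneg n)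

theorem norm_blockTrace_update_sub_le (hz : 0 < z.im) (a : EuclideanSpace ℝ (Fin n)) :
    ‖blockTrace Finset.univ z (Function.update x j a) - blockTrace Finset.univ z x‖ ≤
      2 / (n * z.im) := by
  have h1 := norm_blockTrace_erase_sub_le j x hz
  have h2 := norm_blockTrace_erase_sub_le j (Function.update x j a) hz
  have e : blockTrace (Finset.univ.erase j) z (Function.update x j a) =
      blockTrace (Finset.univ.erase j) z x := by
    rw [blockTrace, gram_update (by simp)]; rfl
  rw [e, norm_sub_rev] at h2
  calc _ = ‖(blockTrace Finset.univ z (Function.update x j a) -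
        blockTrace (Finset.univ.erase j) z x) +
        (blockTrace (Finset.univ.erase j) z x - blockTrace Finset.univ z x)‖ := by
        congr 1; ring
    _ ≤ 1 / (n * z.im) + 1 / (n * z.im) := norm_add_le_of_le h2 h1
    _ = _ := by ring

/-- The Sherman–Morrison formula, summed over the columns. -/
theorem blockTrace_add (hz : 0 < z.im) (hn : n ≠ 0) :
    blockTrace Finset.univ z x + (1 - (m : ℂ) / n) / z =
      -(1 / n) * ∑ j, 1 / (z + columnForm j z x) := by
  have hz0 : z ≠ 0 := by rintro rfl; simp at hz
  have hn' : (n : ℂ) ≠ 0 := by exact_mod_cast hn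
  set R := (gram Finset.univ x).resolvent (z ^ 2) with hR
  have hP := gram_posSemidef Finset.univ x
  have h1 : R * (gram Finset.univ x).shift (z ^ 2) = 1 :=
    mul_eq_one_comm.1 (hP.1.shift_mul_resolvent (hP.eigenvalues_ne_sq hz)).1
  -- each column contributes `1 - z / (z + q)` to `tr (R Y Y*)`
  have hcol : ∀ j, (fun i => (col x j i : ℂ)) ⬝ᵥ R *ᵥ (fun i => (col x j i : ℂ)) =
      1 - z * (1 / (z + columnForm j z x)) := fun j => by
    have hPj := gram_posSemidef (Finset.univ.erase j) x
    have h2 := (hPj.1.shift_mul_resolvent (hPj.eigenvalues_ne_sq hz)).1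
    have h3 : R * ((gram (Finset.univ.erase j) x).shift (z ^ 2) +
        vecMulVec (fun i => (col x j i : ℂ)) (fun i => (col x j i : ℂ))) = 1 := by
      rw [← h1, gram_univ x j]
      congr 1
      ext i k
      simp [shift, vecMulVec]
      ring
    have h4 := shermanMorrison_dotProduct h2 h3
    have h5 : z + columnForm j z x ≠ 0 := by
      intro h
      have := congrArg Complex.im h
      rw [Complex.add_im, Complex.zero_im] at this
      linarith [im_columnForm_nonneg j x hz]
    rw [columnForm] at h5 ⊢
    set d := (fun i => (col x j i : ℂ)) ⬝ᵥ
      (gram (Finset.univ.erase j) x).resolvent (z ^ 2) *ᵥ (fun i => (col x j i : ℂ))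
    set d' := (fun i => (col x j i : ℂ)) ⬝ᵥ R *ᵥ (fun i => (col x j i : ℂ))
    rw [← mul_one_add] at h5 ⊢
    have h6 := right_ne_zero_of_mul h5
    field_simp
    linear_combination h4
  have h6 : (R * (gram Finset.univ x).map Complex.ofRealHom).trace =
      ∑ j, (fun i => (col x j i : ℂ)) ⬝ᵥ R *ᵥ (fun i => (col x j i : ℂ)) := by
    have : (gram Finset.univ x).map Complex.ofRealHom =
        ∑ j, vecMulVec (fun i => (col x j i : ℂ)) (fun i => (col x j i : ℂ)) := by
      ext i k
      simp [gram, vecMulVec, Matrix.sum_apply]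
    rw [this, Finset.mul_sum, trace_sum]
    exact Finset.sum_congr rfl fun j _ => by
      rw [mul_vecMulVec, trace_vecMulVec, dotProduct_comm]
  have h7 : (R * (gram Finset.univ x).map Complex.ofRealHom).trace = n + z ^ 2 * R.trace := by
    have : R * (gram Finset.univ x).map Complex.ofRealHom = 1 + z ^ 2 • R := by
      rw [← h1, shift, Matrix.mul_sub]
      simp
    rw [this, trace_add, trace_smul, trace_one, Fintype.card_fin, smul_eq_mul]
  rw [h7] at h6
  simp only [hcol, Finset.sum_sub_distrib, ← Finset.mul_sum] at h6
  simp only [Finset.sum_const, Finset.card_univ, Fintype.card_fin, nsmul_eq_mul, mul_one] at h6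
  rw [blockTrace, ← hR]
  field_simp
  linear_combination h6

end Gram

/-! ### The approximate self-consistent equation -/

section Expectation

variable {n m : ℕ} {C : ℝ} {γ : Measure (EuclideanSpace ℝ (Fin n))} [IsProbabilityMeasure γ]
  {z : ℂ}

/-- The constant in the variance bound for quadratic forms. -/
def formConst (C : ℝ) : ℝ := 8 * (288 * Real.exp C + 4)

theorem formConst_pos (C : ℝ) : 0 < formConst C := by
  have := Real.exp_pos C
  unfold formConst; positivity

/-- The bounded difference inequality, where replacing a column changes the trace by at most
`2 / (n Im z)`. -/
theorem variance_blockTrace_le (γ : Measure (EuclideanSpace ℝ (Fin n))) [IsProbabilityMeasure γ]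
    (hz : 0 < z.im) :
    ∫ x, ‖blockTrace Finset.univ z x -
      ∫ y, blockTrace Finset.univ z y ∂(Measure.pi fun _ : Fin m => γ)‖ ^ 2
        ∂(Measure.pi fun _ : Fin m => γ) ≤ m * (2 / (n * z.im)) ^ 2 :=
  integral_norm_sub_integral_sq_le_of_bounded_difference
    (continuous_blockTrace _ hz).measurable (fun x => norm_blockTrace_le _ x hz)
    fun x j a => norm_blockTrace_update_sub_le j x hz a

/-- Conditionally on the other columns, the quadratic form of a column is centred at a normalized
trace and has small variance. -/
theorem columnForm_sub_blockTrace (hn : 1 ≤ n) (hi : Isotropic γ)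
    (hc : LipschitzConcentration C γ) (hz : 0 < z.im) (j : Fin m) :
    Integrable (fun x => ‖columnForm j z x - blockTrace (Finset.univ.erase j) z x‖ ^ 2)
      (Measure.pi fun _ : Fin m => γ) ∧
    ∫ x, ‖columnForm j z x - blockTrace (Finset.univ.erase j) z x‖ ^ 2
      ∂(Measure.pi fun _ : Fin m => γ) ≤ formConst C / (n * z.im ^ 2) ∧
    ∫ x, (columnForm j z x - blockTrace (Finset.univ.erase j) z x)
      ∂(Measure.pi fun _ : Fin m => γ) = 0 := by
  have hn0 : (0 : ℝ) < n := by exact_mod_cast hn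
  set π := Measure.pi fun _ : Fin m => γ with hπ
  set G : (Fin m → EuclideanSpace ℝ (Fin n)) → ℂ := fun x =>
    columnForm j z x - blockTrace (Finset.univ.erase j) z x with hG
  have hGc : Continuous G := (continuous_columnForm j hz).sub (continuous_blockTrace _ hz)
  have hmp := measurePreserving_update (ι := Fin m) γ j
  have hmap : π = Measure.map (fun p => Function.update p.1 j p.2) (π.prod γ) := hmp.map_eq.symm
  -- the coefficients of the form in the eigenbasis of the other columns
  let hP := fun x : Fin m → EuclideanSpace ℝ (Fin n) => gram_posSemidef (Finset.univ.erase j) x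
  let α : (Fin m → EuclideanSpace ℝ (Fin n)) → Fin n → ℂ := fun x i =>
    z / (((hP x).1.eigenvalues i : ℂ) - z ^ 2) / n
  have hα : ∀ x i, ‖α x i‖ ≤ 1 / (n * z.im) := fun x i => by
    simp only [α]
    rw [norm_div, Complex.norm_natCast, mul_comm, ← div_div]
    exact div_le_div_of_nonneg_right
      (norm_div_ofReal_sub_sq_le hz ((hP x).eigenvalues_nonneg i)) hn0.le
  have hGα : ∀ x y, G (Function.update x j y) =
      ∑ i, α x i * ((inner ℝ ((hP x).1.eigenvectorBasis i) y ^ 2 : ℝ) : ℂ) - ∑ i, α x i := by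
    intro x y
    simp only [hG, columnForm, blockTrace]
    rw [gram_update (by simp), (hP x).dotProduct_resolvent_sq hz, (hP x).trace_resolvent_sq hz,
      Finset.sum_div]
    congr 1
    refine Finset.sum_congr rfl fun i _ => ?_
    rw [col, Function.update_self, inner_smul_right, mul_pow, inv_pow, Real.sq_sqrt hn0.le]
    push_cast
    simp only [α]
    ring
  have hB : 0 < 1 / (n * z.im) := by positivity
  have var := fun x => hi.variance_form_le (hP x).1.eigenvectorBasis hn hc hB (hα x)
  simp only [← hGα] at var
  have hbound : formConst C * n * (1 / (n * z.im)) ^ 2 = formConst C / (n * z.im ^ 2) := by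
    field_simp
  have hm2 : Measurable fun p : (Fin m → EuclideanSpace ℝ (Fin n)) × EuclideanSpace ℝ (Fin n) =>
      ‖G (Function.update p.1 j p.2)‖ ^ 2 :=
    (hGc.norm.pow 2).measurable.comp hmp.measurable
  have i2p : Integrable (fun p : (Fin m → EuclideanSpace ℝ (Fin n)) × EuclideanSpace ℝ (Fin n) =>
      ‖G (Function.update p.1 j p.2)‖ ^ 2) (π.prod γ) := by
    rw [integrable_prod_iff hm2.aestronglyMeasurable]
    refine ⟨.of_forall fun x => (var x).1, ?_⟩
    refine .of_bound
      hm2.norm.stronglyMeasurable.integral_prod_right'.aestronglyMeasurable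
      (formConst C / (n * z.im ^ 2)) (.of_forall fun x => ?_)
    rw [Real.norm_of_nonneg (integral_nonneg fun y => norm_nonneg _)]
    simp only [norm_pow, norm_norm]
    rw [← hbound]
    exact (var x).2
  have i2 : Integrable (fun x => ‖G x‖ ^ 2) π :=
    (hmp.integrable_comp (hGc.norm.pow 2).aestronglyMeasurable).1 i2p
  have i1 : Integrable G π :=
    ((memLp_two_iff_integrable_sq_norm hGc.aestronglyMeasurable).2 i2).integrable (by norm_num)
  refine ⟨i2, ?_, ?_⟩
  · change ∫ x, ‖G x‖ ^ 2 ∂π ≤ _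
    rw [hmap, integral_map hmp.measurable.aemeasurable (by fun_prop), integral_prod _ i2p]
    calc _ ≤ ∫ _x, formConst C / (n * z.im ^ 2) ∂π :=
          integral_mono i2p.integral_prod_left (integrable_const _) fun x => by
            rw [← hbound]; exact (var x).2
      _ = _ := by simp
  · have i1p : Integrable (fun p : (Fin m → EuclideanSpace ℝ (Fin n)) ×
        EuclideanSpace ℝ (Fin n) => G (Function.update p.1 j p.2)) (π.prod γ) :=
      (hmp.integrable_comp hGc.aestronglyMeasurable).2 i1
    change ∫ x, G x ∂π = 0
    rw [hmap, integral_map hmp.measurable.aemeasurable hGc.aestronglyMeasurable,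
      integral_prod _ i1p]
    refine integral_eq_zero_of_ae (.of_forall fun x => ?_)
    simp only [hGα, Pi.zero_apply]
    rw [integral_sub (LipschitzConcentration.integrable_sum_inner_sq _ hc _) (integrable_const _),
      hi.integral_sum_inner_sq _ hc]
    simp

theorem norm_one_div_sub_expansion_le {ζ a q : ℂ} {v : ℝ} (hv : 0 < v) (ha : v ≤ ‖ζ + a‖)
    (hq : v ≤ ‖ζ + q‖) :
    ‖1 / (ζ + q) - 1 / (ζ + a) + (q - a) / (ζ + a) ^ 2‖ ≤ ‖q - a‖ ^ 2 / v ^ 3 := by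
  have ha0 : ζ + a ≠ 0 := norm_pos_iff.1 (hv.trans_le ha)
  have hq0 : ζ + q ≠ 0 := norm_pos_iff.1 (hv.trans_le hq)
  have e : 1 / (ζ + q) - 1 / (ζ + a) + (q - a) / (ζ + a) ^ 2 =
      (q - a) ^ 2 / ((ζ + a) ^ 2 * (ζ + q)) := by
    field_simp; ring
  rw [e, norm_div, norm_pow, norm_mul, norm_pow, pow_succ v 2]
  gcongr

/-- The second order expansion at the mean of the trace; the first order term is small because
the form and the trace have almost the same mean. -/
theorem norm_expectation_one_div_sub_le (hn : 1 ≤ n) (hi : Isotropic γ)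
    (hc : LipschitzConcentration C γ) (hz : 0 < z.im) (j : Fin m) :
    ‖∫ x, 1 / (z + columnForm j z x) ∂(Measure.pi fun _ : Fin m => γ) -
        1 / (z + ∫ x, blockTrace Finset.univ z x ∂(Measure.pi fun _ : Fin m => γ))‖ ≤
      1 / (n * z.im ^ 3) + 3 * (formConst C + 1 + 4 * (m / n)) / (n * z.im ^ 5) := by
  have hn0 : (0 : ℝ) < n := by exact_mod_cast hn
  have hn1 : (1 : ℝ) ≤ n := by exact_mod_cast hn
  have hVar := variance_blockTrace_le (m := m) γ hz
  obtain ⟨g2, gv, g0⟩ := columnForm_sub_blockTrace hn hi hc hz j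
  set π := Measure.pi fun _ : Fin m => γ with hπ
  set f : (Fin m → EuclideanSpace ℝ (Fin n)) → ℂ := blockTrace Finset.univ z with hf
  set fj : (Fin m → EuclideanSpace ℝ (Fin n)) → ℂ := blockTrace (Finset.univ.erase j) z with hfj
  set q : (Fin m → EuclideanSpace ℝ (Fin n)) → ℂ := columnForm j z with hq
  set a := ∫ x, f x ∂π with ha
  set v := z.im with hv
  have fc : Continuous f := continuous_blockTrace _ hz
  have fjc : Continuous fj := continuous_blockTrace _ hz
  have qc : Continuous q := continuous_columnForm j hz
  have fi : Integrable f π := .of_bound fc.aestronglyMeasurable (1 / v)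
    (.of_forall fun x => norm_blockTrace_le _ x hz)
  have fji : Integrable fj π := .of_bound fjc.aestronglyMeasurable (1 / v)
    (.of_forall fun x => norm_blockTrace_le _ x hz)
  have gi : Integrable (fun x => q x - fj x) π :=
    ((memLp_two_iff_integrable_sq_norm (qc.sub fjc).aestronglyMeasurable).2 g2).integrable
      (by norm_num)
  have a_im : 0 ≤ a.im := by
    have := integral_im fi
    simp only [RCLike.im_eq_complex_im] at this
    rw [ha, ← this]
    exact integral_nonneg fun x => im_blockTrace_nonneg _ x hz
  have lower : ∀ s : ℂ, 0 ≤ s.im → v ≤ ‖z + s‖ := fun s hs => by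
    refine le_trans ?_ (Complex.abs_im_le_norm _)
    rw [Complex.add_im]
    exact le_trans (by linarith) (le_abs_self _)
  have hza := lower a a_im
  have hzq : ∀ x, v ≤ ‖z + q x‖ := fun x => lower _ (im_columnForm_nonneg j x hz)
  -- first and second moments of `q - a`
  have d1i : Integrable (fun x => fj x - f x) π := fji.sub fi
  have d2i : Integrable (fun x => f x - a) π := fi.sub (integrable_const a)
  have split : ∀ x, q x - a = (q x - fj x) + ((fj x - f x) + (f x - a)) := fun x => by ring
  have d3i : Integrable (fun x => (fj x - f x) + (f x - a)) π := d1i.add d2i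
  have qai : Integrable (fun x => q x - a) π := by
    simp only [split]; exact gi.add d3i
  have first : ‖∫ x, (q x - a) ∂π‖ ≤ 1 / (n * v) := by
    have : ∫ x, (q x - a) ∂π = ∫ x, (fj x - f x) ∂π := by
      simp only [split]
      rw [integral_add gi d3i, g0, integral_add d1i d2i, integral_sub fi (integrable_const a)]
      simp [← ha]
    rw [this]
    simpa using norm_integral_le_of_norm_le_const (μ := π)
      (.of_forall fun x => norm_blockTrace_erase_sub_le j x hz)
  have fai : Integrable (fun x => ‖f x - a‖ ^ 2) π := by
    refine .of_bound (by fun_prop) ((1 / v + ‖a‖) ^ 2) (.of_forall fun x => ?_)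
    rw [Real.norm_of_nonneg (by positivity)]
    gcongr
    exact (norm_sub_le _ _).trans (by gcongr; exact norm_blockTrace_le _ x hz)
  have pt : ∀ x, ‖q x - a‖ ^ 2 ≤
      3 * (‖q x - fj x‖ ^ 2 + (1 / (n * v)) ^ 2 + ‖f x - a‖ ^ 2) := fun x => by
    have h1 : ‖q x - a‖ ≤ ‖q x - fj x‖ + (1 / (n * v) + ‖f x - a‖) := by
      rw [split]
      refine norm_add_le_of_le le_rfl (norm_add_le_of_le ?_ le_rfl)
      exact norm_blockTrace_erase_sub_le j x hz
    have h2 : ‖q x - a‖ ^ 2 ≤ (‖q x - fj x‖ + (1 / (n * v) + ‖f x - a‖)) ^ 2 := by gcongr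
    nlinarith [sq_nonneg (‖q x - fj x‖ - 1 / (n * v)), sq_nonneg (‖q x - fj x‖ - ‖f x - a‖),
      sq_nonneg (1 / (n * v) - ‖f x - a‖)]
  have ib0 : Integrable (fun x => ‖q x - fj x‖ ^ 2 + (1 / (n * v)) ^ 2) π :=
    g2.add (integrable_const _)
  have ib : Integrable (fun x =>
      3 * (‖q x - fj x‖ ^ 2 + (1 / (n * v)) ^ 2 + ‖f x - a‖ ^ 2)) π :=
    (ib0.add fai).const_mul 3
  have qa2 : Integrable (fun x => ‖q x - a‖ ^ 2) π :=
    ib.mono' (by fun_prop) (.of_forall fun x => by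
      rw [Real.norm_of_nonneg (by positivity)]; exact pt x)
  have second : ∫ x, ‖q x - a‖ ^ 2 ∂π ≤ 3 * (formConst C + 1 + 4 * (m / n)) / (n * v ^ 2) := by
    refine (integral_mono qa2 ib pt).trans ?_
    rw [integral_const_mul, integral_add ib0 fai, integral_add g2 (integrable_const _)]
    have h1 : (1 / (n * v)) ^ 2 ≤ 1 / (n * v ^ 2) := by
      rw [_root_.one_div_pow, mul_pow]
      gcongr
      nlinarith
    have h2 : m * (2 / (n * v)) ^ 2 = 4 * (m / n) / (n * v ^ 2) := by field_simp; ring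
    rw [h2] at hVar
    simp only [integral_const, probReal_univ, smul_eq_mul, one_mul]
    have h3 : 3 * (formConst C + 1 + 4 * (m / n)) / (n * v ^ 2) =
      3 * (formConst C / (n * v ^ 2) + 1 / (n * v ^ 2) + 4 * (m / n) / (n * v ^ 2)) := by ring
    rw [h3]
    gcongr
  -- the expansion of `1 / (z + q)` at `q = a`
  have hza0 : z + a ≠ 0 := norm_pos_iff.1 (lt_of_lt_of_le hz hza)
  have inv_i : Integrable (fun x => 1 / (z + q x)) π := by
    refine .of_bound (Measurable.aestronglyMeasurable (by fun_prop)) (1 / v)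
      (.of_forall fun x => ?_)
    rw [norm_div, norm_one]
    exact one_div_le_one_div_of_le hz (hzq x)
  have qdi : Integrable (fun x => (q x - a) / (z + a) ^ 2) π := qai.div_const _
  have e0i : Integrable (fun x => 1 / (z + q x) - 1 / (z + a)) π :=
    inv_i.sub (integrable_const _)
  have ei : Integrable (fun x => 1 / (z + q x) - 1 / (z + a) + (q x - a) / (z + a) ^ 2) π :=
    e0i.add qdi
  have e : ∫ x, 1 / (z + q x) ∂π - 1 / (z + a) =
      ∫ x, (1 / (z + q x) - 1 / (z + a) + (q x - a) / (z + a) ^ 2) ∂π -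
        (∫ x, (q x - a) ∂π) / (z + a) ^ 2 := by
    rw [integral_add e0i qdi, integral_sub inv_i (integrable_const _),
      integral_div ((z + a) ^ 2) fun x => q x - a]
    simp
  rw [e]
  have b1 : ‖∫ x, (1 / (z + q x) - 1 / (z + a) + (q x - a) / (z + a) ^ 2) ∂π‖ ≤
      3 * (formConst C + 1 + 4 * (m / n)) / (n * v ^ 2) / v ^ 3 := by
    refine (norm_integral_le_integral_norm _).trans ?_
    refine (integral_mono ei.norm (qa2.div_const (v ^ 3)) fun x =>
      norm_one_div_sub_expansion_le hz hza (hzq x)).trans ?_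
    rw [integral_div]
    gcongr
  have b2 : ‖(∫ x, (q x - a) ∂π) / (z + a) ^ 2‖ ≤ 1 / (n * v) / v ^ 2 := by
    rw [norm_div, norm_pow]
    gcongr
  calc _ ≤ 3 * (formConst C + 1 + 4 * (m / n)) / (n * v ^ 2) / v ^ 3 + 1 / (n * v) / v ^ 2 :=
        (norm_sub_le _ _).trans (add_le_add b1 b2)
    _ = _ := by rw [div_div, div_div, add_comm]; ring_nf

/-- The expected normalized trace solves the equation of the limit up to an error of order
`1 / n`. -/
theorem norm_selfConsistent_le (hn : 1 ≤ n) (hi : Isotropic γ)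
    (hc : LipschitzConcentration C γ) (hz : 0 < z.im) :
    ‖(∫ x, blockTrace Finset.univ z x ∂(Measure.pi fun _ : Fin m => γ)) + (1 - (m : ℂ) / n) / z +
        (m / n) / (z + ∫ x, blockTrace Finset.univ z x ∂(Measure.pi fun _ : Fin m => γ))‖ ≤
      m / n * (1 / (n * z.im ^ 3) + 3 * (formConst C + 1 + 4 * (m / n)) / (n * z.im ^ 5)) := by
  have hn0 : (0 : ℝ) < n := by exact_mod_cast hn
  have hterm := fun j : Fin m => norm_expectation_one_div_sub_le hn hi hc hz j
  set π := Measure.pi fun _ : Fin m => γ with hπ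
  set a := ∫ x, blockTrace Finset.univ z x ∂π with ha
  have fi : Integrable (fun x : Fin m → EuclideanSpace ℝ (Fin n) =>
      blockTrace Finset.univ z x) π :=
    .of_bound (continuous_blockTrace _ hz).aestronglyMeasurable (1 / z.im)
      (.of_forall fun x => norm_blockTrace_le _ x hz)
  have inv_i : ∀ j : Fin m, Integrable (fun x => 1 / (z + columnForm j z x)) π := fun j => by
    have := (continuous_columnForm (n := n) j hz).measurable
    refine .of_bound (Measurable.aestronglyMeasurable (by fun_prop)) (1 / z.im)
      (.of_forall fun x => ?_)
    rw [norm_div, norm_one]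
    refine one_div_le_one_div_of_le hz (le_trans ?_ (Complex.abs_im_le_norm _))
    rw [Complex.add_im]
    exact le_trans (by linarith [im_columnForm_nonneg j x hz]) (le_abs_self _)
  have key : a + (1 - (m : ℂ) / n) / z = -(1 / n) * ∑ j, ∫ x, 1 / (z + columnForm j z x) ∂π := by
    have : ∫ x, (blockTrace Finset.univ z x + (1 - (m : ℂ) / n) / z) ∂π =
        a + (1 - (m : ℂ) / n) / z := by
      rw [integral_add fi (integrable_const _)]; simp [← ha]
    rw [← this]
    simp only [fun x : Fin m → EuclideanSpace ℝ (Fin n) => blockTrace_add x hz (by lia)]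
    rw [integral_const_mul, integral_finsetSum _ fun j _ => inv_i j]
  have e : a + (1 - (m : ℂ) / n) / z + (m / n) / (z + a) =
      -(1 / n) * ∑ j, (∫ x, 1 / (z + columnForm j z x) ∂π - 1 / (z + a)) := by
    rw [key, Finset.sum_sub_distrib]
    simp
    ring
  rw [e, norm_mul, norm_neg, norm_div, norm_one, Complex.norm_natCast]
  calc _ ≤ 1 / (n : ℝ) * ∑ _j : Fin m,
        (1 / ((n : ℝ) * z.im ^ 3) + 3 * (formConst C + 1 + 4 * (m / n)) / (n * z.im ^ 5)) := by
        gcongr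
        exact norm_sum_le_of_le _ fun j _ => hterm j
    _ = _ := by
        rw [Finset.sum_const, Finset.card_univ, Fintype.card_fin, nsmul_eq_mul]; ring

end Expectation

end Wishart

/-! ### The limiting Stieltjes transform -/

namespace Wishart

section Limit

/-- With `p = p₁ + i p₂` and `q = q₁ + i q₂` in the first quadrant, this bounds below the
imaginary part of `p q` times the conjugate of `x + i y`. The hypotheses on `q` say that
`q² = (x + i y)² - r` with `r ≥ 0`, so that `q` has the larger argument. -/
theorem im_mul_conj_aux {x y p₁ p₂ q₁ q₂ : ℝ} (hx : 0 ≤ x) (hy : 0 < y) (hp₁ : 0 ≤ p₁)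
    (hp₂ : 0 ≤ p₂) (hq₁ : 0 ≤ q₁) (hq₂ : 0 ≤ q₂) (h1 : q₁ * q₂ = x * y)
    (h2 : q₁ ^ 2 - q₂ ^ 2 ≤ x ^ 2 - y ^ 2) :
    0 ≤ x * (p₁ * q₂ + p₂ * q₁) - y * (p₁ * q₁ - p₂ * q₂) := by
  have hqx : q₁ ≤ x := by
    by_contra! h
    have h3 : y < q₂ := lt_of_pow_lt_pow_left₀ 2 hq₂ (by nlinarith)
    nlinarith [mul_pos (sub_pos.2 h) hy, mul_nonneg hx (sub_pos.2 h3).le]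
  have hyq : y ≤ q₂ := by
    by_contra! h
    have h3 : q₁ < x := lt_of_pow_lt_pow_left₀ 2 hx (by nlinarith)
    nlinarith [mul_nonneg hq₁ (sub_pos.2 h).le, mul_pos (sub_pos.2 h3) hy]
  have h3 : y * q₁ ≤ x * q₂ := by nlinarith
  nlinarith [mul_nonneg hp₁ (sub_nonneg.2 h3), mul_nonneg (mul_nonneg hx hp₂) hq₁,
    mul_nonneg (mul_nonneg hy.le hp₂) hq₂]

/-- The branch `D` of the square root is the one for which `D / z` has nonnegative imaginary
part on the upper half plane. -/
theorem im_branchSqrt_div_nonneg (c : ℝ) {z : ℂ} (hz : 0 < z.im) :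
    0 ≤ (branchSqrt c z / z).im := by
  have root : ∀ r : ℝ, let p := (z ^ 2 - ((r ^ 2 : ℝ) : ℂ)) ^ (1 / 2 : ℂ)
      0 ≤ p.re ∧ (0 ≤ z.re → 0 ≤ p.im) ∧ (z.re < 0 → p.im ≤ 0) ∧ p.re * p.im = z.re * z.im ∧
        p.re ^ 2 - p.im ^ 2 ≤ z.re ^ 2 - z.im ^ 2 := by
    intro r p
    set ζ := z ^ 2 - ((r ^ 2 : ℝ) : ℂ) with hζ
    have hp : p = ζ ^ (2⁻¹ : ℂ) := by rw [← one_div]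
    have hp2 : p ^ 2 = ζ := by
      rw [hp]; exact_mod_cast Complex.cpow_nat_inv_pow ζ (n := 2) (by norm_num)
    have hre : ζ.re = z.re ^ 2 - z.im ^ 2 - r ^ 2 := by
      rw [hζ, Complex.sub_re, Complex.ofReal_re]; simp [sq]
    have him : ζ.im = 2 * (z.re * z.im) := by
      rw [hζ, Complex.sub_im, Complex.ofReal_im]; simp [sq]; ring
    have h1 := congrArg Complex.re hp2
    have h2 := congrArg Complex.im hp2
    rw [hre] at h1
    rw [him] at h2
    simp only [sq, Complex.mul_re, Complex.mul_im] at h1 h2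
    refine ⟨?_, fun h => ?_, fun h => ?_, by linarith, by nlinarith [sq_nonneg r]⟩
    · rw [hp, Complex.cpow_inv_two_re]; exact Real.sqrt_nonneg _
    · rw [hp, Complex.cpow_inv_two_im_eq_sqrt (by rw [him]; positivity)]
      exact Real.sqrt_nonneg _
    · rw [hp, Complex.cpow_inv_two_im_eq_neg_sqrt (by rw [him]; nlinarith)]
      exact neg_nonpos.2 (Real.sqrt_nonneg _)
  obtain ⟨p1, p2, p3, -, -⟩ := root (√c + 1)
  obtain ⟨q1, q2, q3, q4, q5⟩ := root (√c - 1)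
  rw [Complex.div_im, ← sub_div]
  refine div_nonneg ?_ (Complex.normSq_nonneg z)
  rw [branchSqrt, Complex.mul_re, Complex.mul_im]
  set p := (z ^ 2 - (((√c + 1) ^ 2 : ℝ) : ℂ)) ^ (1 / 2 : ℂ)
  set q := (z ^ 2 - (((√c - 1) ^ 2 : ℝ) : ℂ)) ^ (1 / 2 : ℂ)
  rcases le_or_gt 0 z.re with hx | hx
  · have := im_mul_conj_aux hx hz p1 (p2 hx) q1 (q2 hx) q4 q5
    linarith
  · have := im_mul_conj_aux (neg_pos.2 hx).le hz p1 (neg_nonneg.2 (p3 hx)) q1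
      (neg_nonneg.2 (q3 hx)) (by linarith) (by rw [neg_sq, neg_sq]; exact q5)
    linarith

theorem im_neg_div_nonneg {c : ℝ} (hc : 1 ≤ c) {z : ℂ} (hz : 0 < z.im) :
    0 ≤ (-((c - 1) / z) : ℂ).im := by
  have : (-((c - 1) / z) : ℂ) = ((c - 1 : ℝ) : ℂ) * (-z⁻¹) := by push_cast; ring
  rw [this, Complex.im_ofReal_mul, Complex.neg_im, Complex.inv_im]
  refine mul_nonneg (by linarith) ?_
  rw [neg_div, neg_neg]
  exact div_nonneg hz.le (Complex.normSq_nonneg z)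

theorem s₁_quadratic {c : ℝ} (hc : 0 ≤ c) {z : ℂ} (hz : z ≠ 0) :
    s₁ c z ^ 2 + (z - (c - 1) / z) * s₁ c z + 1 = 0 := by
  have h := (branchSqrt_sq hc z).1
  rw [s₁]
  field_simp
  linear_combination h

/-- Of the two roots of the quadratic equation, which are inverse to each other, `s₁` is the one
in the closed upper half plane. -/
theorem im_s₁_nonneg {c : ℝ} (hc : 1 ≤ c) {z : ℂ} (hz : 0 < z.im) : 0 ≤ (s₁ c z).im := by
  have hz0 : z ≠ 0 := by rintro rfl; simp at hz
  have hq := s₁_quadratic (zero_le_one.trans hc) hz0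
  have hs0 : s₁ c z ≠ 0 := by rintro h; simp [h] at hq
  have hD := im_branchSqrt_div_nonneg c hz
  -- the other root is the inverse
  have hinv : s₁ c z - (s₁ c z)⁻¹ = branchSqrt c z / z := by
    have h1 : (s₁ c z)⁻¹ = -(s₁ c z + (z - (c - 1) / z)) := by
      refine inv_eq_of_mul_eq_one_right ?_
      linear_combination -hq
    rw [h1, s₁]; field_simp; ring
  by_contra! hneg
  have h2 := congrArg Complex.im hinv
  rw [Complex.sub_im, Complex.inv_im] at h2
  have h3 : 0 < -(s₁ c z).im / Complex.normSq (s₁ c z) :=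
    div_pos (by linarith) (Complex.normSq_pos.2 hs0)
  linarith

/-- Stability: a point of the upper half plane that nearly solves the quadratic equation is near
`s₁`, since the difference of the values of the quadratic at `a` and `s₁` is
`(a - s₁) (a + s₁ + z - (c - 1) / z)` and the second factor has imaginary part at least `Im z`. -/
theorem norm_sub_s₁_mul_im_le {c : ℝ} (hc : 1 ≤ c) {z a : ℂ} (hz : 0 < z.im) (ha : 0 ≤ a.im) :
    ‖a - s₁ c z‖ * z.im ≤ ‖a ^ 2 + (z - (c - 1) / z) * a + 1‖ := by
  have hz0 : z ≠ 0 := by rintro rfl; simp at hz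
  have hq := s₁_quadratic (zero_le_one.trans hc) hz0
  have e : a ^ 2 + (z - (c - 1) / z) * a + 1 =
      (a - s₁ c z) * (a + s₁ c z + z + -((c - 1) / z)) := by linear_combination hq
  rw [e, norm_mul]
  gcongr
  refine le_trans ?_ (Complex.abs_im_le_norm _)
  rw [Complex.add_im, Complex.add_im, Complex.add_im]
  have h1 := im_s₁_nonneg hc hz
  have h2 := im_neg_div_nonneg hc hz
  exact le_trans (by linarith) (le_abs_self _)

theorem sLim_eq {c : ℝ} (hc : 0 < c) {z : ℂ} (hz : z ≠ 0) :
    sLim c z = (2 * s₁ c z - (c - 1) / z) / (1 + c) := by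
  have hc' : (c : ℂ) ≠ 0 := by exact_mod_cast hc.ne'
  rw [sLim, s₁, s₂]
  congr 1
  field_simp
  ring

theorem sLim_eq_branchSqrt {c : ℝ} (hc : 0 < c) {z : ℂ} (hz : z ≠ 0) :
    sLim c z = -(1 / (1 + (c : ℂ))) * (z - branchSqrt c z / z) := by
  have hc' : (1 + c : ℂ) ≠ 0 := by exact_mod_cast (by positivity : (1 + c : ℝ) ≠ 0)
  rw [sLim_eq hc hz, s₁]
  field_simp
  ring

theorem sLim_neg (c : ℝ) (z : ℂ) : sLim c (-z) = -sLim c z := by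
  have h : branchSqrt c (-z) = branchSqrt c z := by simp [branchSqrt]
  simp only [sLim, s₁, s₂, h]
  rcases eq_or_ne z 0 with rfl | hz
  · simp
  · rw [neg_sq, mul_neg, mul_neg, div_neg, div_neg]; ring

end Limit

/-! ### The empirical Stieltjes transform -/

section Empirical

open Matrix

theorem stieltjes_empiricalSpectral {ι : Type*} [Fintype ι] [DecidableEq ι] {A : Matrix ι ι ℝ}
    (hA : A.IsHermitian) {z : ℂ} (hz : z.im ≠ 0) :
    stieltjes (empiricalSpectral hA) z = (A.resolvent z).trace / Fintype.card ι := by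
  have hne : ∀ i, (hA.eigenvalues i : ℂ) ≠ z := fun i h => hz (by rw [← h]; simp)
  have hcont : Continuous fun x : ℝ => ((x : ℂ) - z)⁻¹ :=
    (by fun_prop : Continuous fun x : ℝ => (x : ℂ) - z).inv₀ fun x h => hz (by
      rw [← sub_eq_zero.1 h]; simp)
  rw [(hA.shift_mul_resolvent hne).2, hA.trace_spectralMatrix, stieltjes, empiricalSpectral,
    integral_smul_measure, integral_finsetSum_measure]
  · simp only [integral_dirac]
    rw [ENNReal.toReal_inv, ENNReal.toReal_natCast, Complex.real_smul]
    push_cast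
    rw [div_eq_inv_mul]
  · exact fun i _ => integrable_dirac (by simp)

variable {n m : ℕ} (X : Fin m → EuclideanSpace ℝ (Fin n))

theorem columnMatrix_mul_transpose :
    columnMatrix X * (columnMatrix X)ᵀ = gram Finset.univ X := by
  ext i k
  simp [columnMatrix, gram, col, mul_apply, Matrix.sum_apply, vecMulVec, div_eq_inv_mul]

/-- The trace of the resolvent of `W` in terms of the resolvent of `Y Y*`. -/
theorem trace_resolvent_blockMatrix {z : ℂ} (hz : z ≠ 0)
    (h : (gram Finset.univ X).shift (z ^ 2) * (gram Finset.univ X).resolvent (z ^ 2) = 1) :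
    ((blockMatrix X).resolvent z).trace =
      2 * (z * ((gram Finset.univ X).resolvent (z ^ 2)).trace) - (m - n) / z := by
  set R := (gram Finset.univ X).resolvent (z ^ 2) with hR
  set Y := (columnMatrix X).map Complex.ofRealHom with hY
  have hYY : Y * Yᵀ = (gram Finset.univ X).map Complex.ofRealHom := by
    rw [← columnMatrix_mul_transpose, Matrix.map_mul, hY, transpose_map]
  have hYR : Y * Yᵀ * R = 1 + z ^ 2 • R := by
    rw [hYY, ← h, shift, Matrix.sub_mul]; simp
  have hW : (blockMatrix X).shift z = fromBlocks (-(z • 1)) Yᵀ Y (-(z • 1)) := by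
    rw [shift, blockMatrix, ← fromBlocks_one, fromBlocks_map, fromBlocks_smul, sub_eq_add_neg,
      fromBlocks_neg, fromBlocks_add, conjTranspose_eq_transpose_of_trivial]
    simp [hY, transpose_map]
  have hinv : (blockMatrix X).resolvent z =
      fromBlocks (z⁻¹ • (Yᵀ * R * Y - 1)) (Yᵀ * R) (R * Y) (z • R) := by
    refine inv_eq_right_inv ?_
    rw [hW, fromBlocks_multiply, ← fromBlocks_one]
    congr 1
    · simp [smul_smul, hz, Matrix.mul_assoc]
    · simp
    · have : Y * (Yᵀ * R * Y) = Y + z ^ 2 • (R * Y) := by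
        calc Y * (Yᵀ * R * Y) = Y * Yᵀ * R * Y := by simp only [Matrix.mul_assoc]
          _ = _ := by rw [hYR, Matrix.add_mul, Matrix.one_mul, smul_mul]
      rw [Matrix.mul_smul, Matrix.mul_sub, this, Matrix.mul_one, add_sub_cancel_left, smul_smul,
        Matrix.neg_mul, smul_mul, Matrix.one_mul, sq, inv_mul_cancel_left₀ hz]
      simp
    · rw [← Matrix.mul_assoc, hYR]
      simp [smul_smul, sq]
  have htr : (Yᵀ * R * Y).trace = n + z ^ 2 * R.trace := by
    rw [trace_mul_comm, ← Matrix.mul_assoc, hYR, trace_add, trace_smul, trace_one,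
      Fintype.card_fin, smul_eq_mul]
  have tr_blocks : ∀ (A : Matrix (Fin m) (Fin m) ℂ) (B D) (E : Matrix (Fin n) (Fin n) ℂ),
      (fromBlocks A B D E).trace = A.trace + E.trace := fun A B D E => by
    simp [trace, Fintype.sum_sum_type]
  rw [hinv, tr_blocks, trace_smul, trace_smul, trace_sub, htr, trace_one,
    Fintype.card_fin, smul_eq_mul, smul_eq_mul]
  field_simp
  ring

theorem shift_gram_mul_resolvent {z : ℂ} (hz : z.im ≠ 0) :
    (gram Finset.univ X).shift (z ^ 2) * (gram Finset.univ X).resolvent (z ^ 2) = 1 := by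
  have hP := gram_posSemidef Finset.univ X
  rcases lt_or_gt_of_ne hz with h | h
  · have := (hP.1.shift_mul_resolvent
      (hP.eigenvalues_ne_sq (z := -z) (by rw [Complex.neg_im]; linarith))).1
    rwa [neg_sq] at this
  · exact (hP.1.shift_mul_resolvent (hP.eigenvalues_ne_sq h)).1

theorem sEmp_eq_trace {z : ℂ} (hz : z.im ≠ 0) :
    sEmp X z =
      (2 * (z * ((gram Finset.univ X).resolvent (z ^ 2)).trace) - (m - n) / z) / (m + n) := by
  have hz0 : z ≠ 0 := by rintro rfl; simp at hz
  rw [sEmp, stieltjes_empiricalSpectral _ hz,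
    trace_resolvent_blockMatrix X hz0 (shift_gram_mul_resolvent X hz), Fintype.card_sum,
    Fintype.card_fin, Fintype.card_fin]
  push_cast
  rfl

theorem sEmp_neg {z : ℂ} (hz : z.im ≠ 0) : sEmp X (-z) = -sEmp X z := by
  rw [sEmp_eq_trace X hz, sEmp_eq_trace X (by simpa using hz), neg_sq, div_neg]
  ring

theorem sEmp_eq_blockTrace (hn : n ≠ 0) {z : ℂ} (hz : 0 < z.im) :
    sEmp X z =
      (2 * blockTrace Finset.univ z X - ((m : ℂ) / n - 1) / z) / (1 + (m : ℂ) / n) := by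
  have hn' : (n : ℂ) ≠ 0 := by exact_mod_cast hn
  have hz0 : z ≠ 0 := by rintro rfl; simp at hz
  have hmn : (m : ℂ) + n ≠ 0 := by exact_mod_cast (by omega : m + n ≠ 0)
  have hmn' : (n : ℂ) + m ≠ 0 := by rwa [add_comm]
  rw [sEmp_eq_trace X hz.ne', blockTrace]
  have : (1 + (m : ℂ) / n) = (n + m) / n := by field_simp
  rw [this]
  field_simp
  ring

end Empirical

end Wishart

/-! ### Quantitative convergence for independent columns -/

namespace Wishart

section Quantitative

open Matrix

variable {n m : ℕ}

theorem continuous_sEmp {z : ℂ} (hz : z.im ≠ 0) :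
    Continuous fun x : Fin m → EuclideanSpace ℝ (Fin n) => sEmp x z := by
  simp only [fun x : Fin m → EuclideanSpace ℝ (Fin n) => sEmp_eq_trace x hz]
  have := (continuous_resolvent (continuous_gram (n := n) (m := m) Finset.univ)
    fun x => shift_gram_mul_resolvent x hz).matrix_trace
  fun_prop

theorem norm_sEmp_le (x : Fin m → EuclideanSpace ℝ (Fin n)) {z : ℂ} (hz : z.im ≠ 0) :
    ‖sEmp x z‖ ≤ 1 / |z.im| := by
  have hA := blockMatrix_isHermitian x
  have hne : ∀ i, (hA.eigenvalues i : ℂ) ≠ z := fun i h => hz (by rw [← h]; simp)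
  rw [sEmp, stieltjes_empiricalSpectral _ hz, (hA.shift_mul_resolvent hne).2,
    hA.trace_spectralMatrix, norm_div, Complex.norm_natCast]
  refine div_le_of_le_mul₀ (by positivity) (by positivity) ?_
  refine (norm_sum_le_of_le _ (f := fun i => ((hA.eigenvalues i : ℂ) - z)⁻¹)
    (n := fun _ => 1 / |z.im|) fun i _ => ?_).trans ?_
  · rw [norm_inv, inv_eq_one_div]
    refine one_div_le_one_div_of_le (abs_pos.2 hz) ?_
    simpa using Complex.abs_im_le_norm ((hA.eigenvalues i : ℂ) - z)
  · simp [mul_comm]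

variable {C : ℝ} {γ : Measure (EuclideanSpace ℝ (Fin n))} [IsProbabilityMeasure γ] {c r τ R : ℝ}
  {z : ℂ}

/-- The constant in the rate of convergence of the expectation: `r` bounds `m / n` and `τ`
bounds `n |m / n - c|`. -/
def rateConst (C r τ R : ℝ) : ℝ :=
  (6 * τ + 2 * (r * (1 + 3 * (formConst C + 1 + 4 * r)) * (R + 1))) * R ^ 12

/-- The rate of convergence of the expected normalized trace, in terms of any `T ≥ 1` with
`1 / Im z ≤ T`. -/
theorem norm_integral_blockTrace_sub_le (hn : 1 ≤ n) (hi : Isotropic γ)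
    (hc : LipschitzConcentration C γ) (hc1 : 1 ≤ c) (hz : 0 < z.im) (hR0 : 0 ≤ R) (hzR : ‖z‖ ≤ R)
    (hr : (m : ℝ) / n ≤ r) (hτ : |(m : ℝ) / n - c| ≤ τ / n) {T : ℝ} (hT1 : 1 ≤ T)
    (hT : 1 / z.im ≤ T) :
    ‖∫ x, blockTrace Finset.univ z x ∂(Measure.pi fun _ : Fin m => γ) - s₁ c z‖ ≤
      (r * (1 + 3 * (formConst C + 1 + 4 * r)) * (R + 1) + τ) * T ^ 7 / n := by
  have hn0 : (0 : ℝ) < n := by exact_mod_cast hn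
  have hz0 : z ≠ 0 := by rintro rfl; simp at hz
  have hself := norm_selfConsistent_le (m := m) hn hi hc hz
  have hKpos := formConst_pos C
  have hρ0 : 0 ≤ (m : ℝ) / n := by positivity
  have hr0 : 0 ≤ r := hρ0.trans hr
  have hτ0 : 0 ≤ τ := by
    by_contra! h
    have := div_neg_of_neg_of_pos h hn0
    linarith [abs_nonneg ((m : ℝ) / n - c)]
  set π := Measure.pi fun _ : Fin m => γ with hπ
  set a := ∫ x, blockTrace Finset.univ z x ∂π with ha
  set v := z.im with hv
  have fi : Integrable (fun x : Fin m → EuclideanSpace ℝ (Fin n) =>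
      blockTrace Finset.univ z x) π :=
    .of_bound (continuous_blockTrace _ hz).aestronglyMeasurable (1 / v)
      (.of_forall fun x => norm_blockTrace_le _ x hz)
  have a_norm : ‖a‖ ≤ 1 / v := by
    simpa using norm_integral_le_of_norm_le_const (μ := π)
      (.of_forall fun x => norm_blockTrace_le Finset.univ x hz)
  have a_im : 0 ≤ a.im := by
    have := integral_im fi
    simp only [RCLike.im_eq_complex_im] at this
    rw [ha, ← this]
    exact integral_nonneg fun x => im_blockTrace_nonneg _ x hz
  have hza0 : z + a ≠ 0 := by
    intro h
    have := congrArg Complex.im h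
    rw [Complex.add_im, Complex.zero_im] at this
    linarith
  set E := a + (1 - (m : ℂ) / n) / z + (m / n) / (z + a) with hE
  set K := 1 + 3 * (formConst C + 1 + 4 * r) with hK
  have hK0 : 0 ≤ K := by positivity
  have E_norm : ‖E‖ ≤ r * K * T ^ 5 / n := by
    refine hself.trans ?_
    have h3 : 1 / (n * v ^ 3) ≤ T ^ 5 / n := by
      have : (1 / v) ^ 3 ≤ T ^ 5 :=
        (pow_le_pow_left₀ (by positivity) hT 3).trans (pow_le_pow_right₀ hT1 (by norm_num))
      calc 1 / (n * v ^ 3) = (1 / v) ^ 3 / n := by field_simp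
        _ ≤ _ := by gcongr
    have h5 : 3 * (formConst C + 1 + 4 * (m / n)) / (n * v ^ 5) ≤
        3 * (formConst C + 1 + 4 * r) * (T ^ 5 / n) := by
      have : (1 / v) ^ 5 ≤ T ^ 5 := pow_le_pow_left₀ (by positivity) hT 5
      calc 3 * (formConst C + 1 + 4 * (m / n)) / (n * v ^ 5)
          = 3 * (formConst C + 1 + 4 * (m / n)) * ((1 / v) ^ 5 / n) := by field_simp
        _ ≤ _ := by gcongr
    calc _ ≤ r * (T ^ 5 / n + 3 * (formConst C + 1 + 4 * r) * (T ^ 5 / n)) := by gcongr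
      _ = _ := by rw [hK]; ring
  have hquad : a ^ 2 + (z - (c - 1) / z) * a + 1 =
      E * (z + a) + (((m : ℝ) / n - c : ℝ) : ℂ) * (a / z) := by
    rw [hE]; push_cast; field_simp; ring
  have z_inv : ‖z‖⁻¹ ≤ T := by
    refine le_trans ?_ hT
    rw [← one_div]
    exact one_div_le_one_div_of_le hz ((le_abs_self _).trans (Complex.abs_im_le_norm z))
  have hstab := norm_sub_s₁_mul_im_le hc1 hz a_im
  rw [hquad, ← hv] at hstab
  have b1 : ‖E * (z + a)‖ ≤ r * K * T ^ 5 / n * ((R + 1) * T) := by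
    rw [norm_mul]
    gcongr
    calc ‖z + a‖ ≤ R + T := norm_add_le_of_le hzR (a_norm.trans hT)
      _ ≤ (R + 1) * T := by nlinarith
  have b2 : ‖(((m : ℝ) / n - c : ℝ) : ℂ) * (a / z)‖ ≤ τ / n * T ^ 6 := by
    rw [norm_mul, norm_div, Complex.norm_real, Real.norm_eq_abs]
    gcongr
    calc ‖a‖ / ‖z‖ = ‖a‖ * ‖z‖⁻¹ := div_eq_mul_inv _ _
      _ ≤ T * T := by gcongr; exact a_norm.trans hT
      _ = T ^ 2 := (sq T).symm
      _ ≤ T ^ 6 := pow_le_pow_right₀ hT1 (by norm_num)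
  have b3 := hstab.trans ((norm_add_le _ _).trans (add_le_add b1 b2))
  calc ‖a - s₁ c z‖ = ‖a - s₁ c z‖ * v * (1 / v) := by field_simp
    _ ≤ (r * K * T ^ 5 / n * ((R + 1) * T) + τ / n * T ^ 6) * T := by gcongr
    _ = _ := by ring

theorem norm_integral_sEmp_sub_sLim_le_of_im_pos (hn : 1 ≤ n) (hi : Isotropic γ)
    (hc : LipschitzConcentration C γ) (hc1 : 1 ≤ c) (hz : 0 < z.im) (hR : 1 ≤ R) (hzR : ‖z‖ ≤ R)
    (hr : (m : ℝ) / n ≤ r) (hτ : |(m : ℝ) / n - c| ≤ τ / n) :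
    ‖∫ x, sEmp x z ∂(Measure.pi fun _ : Fin m => γ) - sLim c z‖ ≤
      rateConst C r τ R * (z.im⁻¹ ^ 12 / n) := by
  have hn0 : (0 : ℝ) < n := by exact_mod_cast hn
  have hz0 : z ≠ 0 := by rintro rfl; simp at hz
  have hzim : z.im ≤ ‖z‖ := (le_abs_self _).trans (Complex.abs_im_le_norm z)
  set T := R / z.im with hTdef
  have hT1 : 1 ≤ T := (one_le_div hz).2 (hzim.trans hzR)
  have hT : 1 / z.im ≤ T := div_le_div_of_nonneg_right hR hz.le
  have hmain := norm_integral_blockTrace_sub_le hn hi hc hc1 hz (by linarith) hzR hr hτ hT1 hT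
  have hKpos := formConst_pos C
  have hρ0 : 0 ≤ (m : ℝ) / n := by positivity
  have hr0 : 0 ≤ r := hρ0.trans hr
  have hτ0 : 0 ≤ τ / n := (abs_nonneg _).trans hτ
  have hτ1 : 0 ≤ τ := by
    have := mul_nonneg hτ0 hn0.le
    rwa [div_mul_cancel₀ _ hn0.ne'] at this
  set π := Measure.pi fun _ : Fin m => γ with hπ
  set a := ∫ x, blockTrace Finset.univ z x ∂π with ha
  set ρ : ℝ := (m : ℝ) / n with hρ
  have hρC : ((m : ℂ) / n) = (ρ : ℂ) := by rw [hρ]; push_cast; rfl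
  have fi : Integrable (fun x : Fin m → EuclideanSpace ℝ (Fin n) =>
      blockTrace Finset.univ z x) π :=
    .of_bound (continuous_blockTrace _ hz).aestronglyMeasurable (1 / z.im)
      (.of_forall fun x => norm_blockTrace_le _ x hz)
  have a_norm : ‖a‖ ≤ T := by
    refine le_trans ?_ hT
    simpa using norm_integral_le_of_norm_le_const (μ := π)
      (.of_forall fun x => norm_blockTrace_le Finset.univ x hz)
  have z_inv : ‖z‖⁻¹ ≤ T := by
    refine le_trans ?_ hT
    rw [← one_div]
    exact one_div_le_one_div_of_le hz hzim
  have mean : ∫ x, sEmp x z ∂π = (2 * a - ((ρ : ℂ) - 1) / z) / (1 + ρ) := by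
    simp only [fun x : Fin m → EuclideanSpace ℝ (Fin n) =>
      sEmp_eq_blockTrace x (by omega : n ≠ 0) hz, hρC]
    rw [integral_div, integral_sub (fi.const_mul 2) (integrable_const _), integral_const_mul]
    simp [← ha]
  have h1ρ : (1 + ρ : ℂ) ≠ 0 := by exact_mod_cast (by positivity : (1 + ρ : ℝ) ≠ 0)
  have h1c : (1 + c : ℂ) ≠ 0 := by exact_mod_cast (by positivity : (1 + c : ℝ) ≠ 0)
  have e : ∫ x, sEmp x z ∂π - sLim c z =
      (2 * a - ((ρ - 1 : ℝ) : ℂ) * z⁻¹) * ((c - ρ : ℝ) / ((1 + ρ : ℝ) * (1 + c : ℝ)) : ℝ) +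
        (2 * (a - s₁ c z) - ((ρ - c : ℝ) : ℂ) * z⁻¹) * ((1 / (1 + c) : ℝ) : ℂ) := by
    rw [mean, sLim_eq (by linarith) hz0]
    push_cast
    field_simp
    ring
  have b1 : ‖(2 * a - ((ρ - 1 : ℝ) : ℂ) * z⁻¹) *
      ((c - ρ : ℝ) / ((1 + ρ : ℝ) * (1 + c : ℝ)) : ℝ)‖ ≤ 3 * (τ / n) * T := by
    have n1 : ‖2 * a - ((ρ - 1 : ℝ) : ℂ) * z⁻¹‖ ≤ 2 * T + (1 + ρ) * T := by
      refine norm_sub_le_of_le ?_ ?_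
      · rw [norm_mul, Complex.norm_ofNat]; gcongr
      · rw [norm_mul, Complex.norm_real, norm_inv, Real.norm_eq_abs]
        gcongr
        rw [abs_le]; constructor <;> linarith
    rw [norm_mul, Complex.norm_real, Real.norm_eq_abs, abs_div, abs_sub_comm,
      abs_of_pos (by positivity : 0 < (1 + ρ) * (1 + c)), ← mul_div_assoc,
      div_le_iff₀ (by positivity)]
    calc _ ≤ (2 * T + (1 + ρ) * T) * (τ / n) := by gcongr
      _ ≤ (3 * (1 + ρ) * T) * (τ / n) := by gcongr; nlinarith
      _ = 3 * (τ / n) * T * ((1 + ρ) * 1) := by ring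
      _ ≤ _ := by gcongr; linarith
  have b2 : ‖(2 * (a - s₁ c z) - ((ρ - c : ℝ) : ℂ) * z⁻¹) * ((1 / (1 + c) : ℝ) : ℂ)‖ ≤
      2 * ((r * (1 + 3 * (formConst C + 1 + 4 * r)) * (R + 1) + τ) * T ^ 7 / n) + τ / n * T := by
    rw [norm_mul, Complex.norm_real, Real.norm_of_nonneg (by positivity)]
    refine (mul_le_of_le_one_right (norm_nonneg _) ?_).trans ?_
    · rw [div_le_one (by linarith)]; linarith
    · refine norm_sub_le_of_le ?_ ?_
      · rw [norm_mul, Complex.norm_ofNat]; gcongr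
      · rw [norm_mul, Complex.norm_real, norm_inv, Real.norm_eq_abs]; gcongr
  rw [e]
  have t1 : T ≤ T ^ 12 := le_self_pow₀ hT1 (by norm_num)
  have t7 : T ^ 7 ≤ T ^ 12 := pow_le_pow_right₀ hT1 (by norm_num)
  calc _ ≤ 3 * (τ / n) * T + (2 * ((r * (1 + 3 * (formConst C + 1 + 4 * r)) * (R + 1) + τ) *
        T ^ 7 / n) + τ / n * T) := norm_add_le_of_le b1 b2
    _ ≤ 3 * (τ / n) * T ^ 12 + (2 * ((r * (1 + 3 * (formConst C + 1 + 4 * r)) * (R + 1) + τ) *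
        T ^ 12 / n) + τ / n * T ^ 12) := by gcongr
    _ = rateConst C r τ R * (z.im⁻¹ ^ 12 / n) := by
        rw [rateConst, hTdef]; ring

theorem variance_sEmp_le_of_im_pos (γ : Measure (EuclideanSpace ℝ (Fin n)))
    [IsProbabilityMeasure γ] (hn : 1 ≤ n) (hz : 0 < z.im) (hr : (m : ℝ) / n ≤ r) :
    ∫ x, ‖sEmp x z - ∫ y, sEmp y z ∂(Measure.pi fun _ : Fin m => γ)‖ ^ 2
      ∂(Measure.pi fun _ : Fin m => γ) ≤ 16 * r * (z.im⁻¹ ^ 2 / n) := by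
  have hn0 : (0 : ℝ) < n := by exact_mod_cast hn
  have hvar := variance_blockTrace_le (m := m) γ hz
  set π := Measure.pi fun _ : Fin m => γ with hπ
  set ρ : ℝ := (m : ℝ) / n with hρ
  have hρ0 : 0 ≤ ρ := by positivity
  have hρC : ((m : ℂ) / n) = (ρ : ℂ) := by rw [hρ]; push_cast; rfl
  have h1ρ : (1 + ρ : ℂ) ≠ 0 := by exact_mod_cast (by positivity : (1 + ρ : ℝ) ≠ 0)
  have fi : Integrable (fun x : Fin m → EuclideanSpace ℝ (Fin n) =>
      blockTrace Finset.univ z x) π :=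
    .of_bound (continuous_blockTrace _ hz).aestronglyMeasurable (1 / z.im)
      (.of_forall fun x => norm_blockTrace_le _ x hz)
  simp only [fun x : Fin m → EuclideanSpace ℝ (Fin n) =>
    sEmp_eq_blockTrace x (by omega : n ≠ 0) hz, hρC]
  set a := ∫ x, blockTrace Finset.univ z x ∂π with ha
  have mean : ∫ x : Fin m → EuclideanSpace ℝ (Fin n),
      (2 * blockTrace Finset.univ z x - ((ρ : ℂ) - 1) / z) / (1 + ρ) ∂π =
      (2 * a - ((ρ : ℂ) - 1) / z) / (1 + ρ) := by
    rw [integral_div, integral_sub (fi.const_mul 2) (integrable_const _), integral_const_mul]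
    simp [← ha]
  rw [mean]
  have pt : ∀ x : Fin m → EuclideanSpace ℝ (Fin n),
      ‖(2 * blockTrace Finset.univ z x - ((ρ : ℂ) - 1) / z) / (1 + ρ) -
        (2 * a - ((ρ : ℂ) - 1) / z) / (1 + ρ)‖ ^ 2 =
      (2 / (1 + ρ)) ^ 2 * ‖blockTrace Finset.univ z x - a‖ ^ 2 := fun x => by
    have : (2 * blockTrace Finset.univ z x - ((ρ : ℂ) - 1) / z) / (1 + ρ) -
        (2 * a - ((ρ : ℂ) - 1) / z) / (1 + ρ) =
        ((2 / (1 + ρ) : ℝ) : ℂ) * (blockTrace Finset.univ z x - a) := by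
      push_cast; field_simp; ring
    rw [this, norm_mul, mul_pow, Complex.norm_real, Real.norm_of_nonneg (by positivity)]
  simp only [pt]
  rw [integral_const_mul]
  have h2 : (2 / (1 + ρ)) ^ 2 ≤ 2 ^ 2 := by
    gcongr
    rw [div_le_iff₀ (by positivity)]; linarith
  calc _ ≤ 2 ^ 2 * (m * (2 / (n * z.im)) ^ 2) := by gcongr
    _ = 16 * ρ * (z.im⁻¹ ^ 2 / n) := by rw [hρ]; field_simp; ring
    _ ≤ _ := by gcongr

/-- Both half planes are covered by the symmetry `z ↦ -z`. -/
theorem norm_integral_sEmp_sub_sLim_le (hn : 1 ≤ n) (hi : Isotropic γ)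
    (hc : LipschitzConcentration C γ) (hc1 : 1 ≤ c) (hz : z.im ≠ 0) (hR : 1 ≤ R) (hzR : ‖z‖ ≤ R)
    (hr : (m : ℝ) / n ≤ r) (hτ : |(m : ℝ) / n - c| ≤ τ / n) :
    ‖∫ x, sEmp x z ∂(Measure.pi fun _ : Fin m => γ) - sLim c z‖ ≤
      rateConst C r τ R * (|z.im|⁻¹ ^ 12 / n) := by
  rcases lt_or_gt_of_ne hz with h | h
  · have := norm_integral_sEmp_sub_sLim_le_of_im_pos (m := m) (z := -z) hn hi hc hc1
      (by rw [Complex.neg_im]; linarith) hR (by rwa [norm_neg]) hr hτ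
    simp only [fun x : Fin m → EuclideanSpace ℝ (Fin n) => sEmp_neg x hz, sLim_neg,
      integral_neg, Complex.neg_im] at this
    rwa [neg_sub_neg, norm_sub_rev, ← abs_of_neg h] at this
  · rw [abs_of_pos h]
    exact norm_integral_sEmp_sub_sLim_le_of_im_pos hn hi hc hc1 h hR hzR hr hτ

theorem variance_sEmp_le (γ : Measure (EuclideanSpace ℝ (Fin n)))
    [IsProbabilityMeasure γ] (hn : 1 ≤ n) (hz : z.im ≠ 0) (hr : (m : ℝ) / n ≤ r) :
    ∫ x, ‖sEmp x z - ∫ y, sEmp y z ∂(Measure.pi fun _ : Fin m => γ)‖ ^ 2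
      ∂(Measure.pi fun _ : Fin m => γ) ≤ 16 * r * (|z.im|⁻¹ ^ 2 / n) := by
  rcases lt_or_gt_of_ne hz with h | h
  · have := variance_sEmp_le_of_im_pos (m := m) (z := -z) γ hn
      (by rw [Complex.neg_im]; linarith) hr
    simp only [fun x : Fin m → EuclideanSpace ℝ (Fin n) => sEmp_neg x hz,
      integral_neg, Complex.neg_im, neg_sub_neg, norm_sub_rev (∫ _, _ ∂_)] at this
    rwa [← abs_of_neg h] at this
  · rw [abs_of_pos h]
    exact variance_sEmp_le_of_im_pos γ hn h hr

/-- The mean square error is the sum of the variance and the square of the bias. -/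
theorem integral_norm_sEmp_sub_sLim_sq_le (hn : 1 ≤ n) (hi : Isotropic γ)
    (hc : LipschitzConcentration C γ) (hc1 : 1 ≤ c) (hz : z.im ≠ 0) (hR : 1 ≤ R) (hzR : ‖z‖ ≤ R)
    (hr : (m : ℝ) / n ≤ r) (hτ : |(m : ℝ) / n - c| ≤ τ / n) :
    ∫ x, ‖sEmp x z - sLim c z‖ ^ 2 ∂(Measure.pi fun _ : Fin m => γ) ≤
      16 * r * (|z.im|⁻¹ ^ 2 / n) + (rateConst C r τ R * (|z.im|⁻¹ ^ 12 / n)) ^ 2 := by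
  rw [integral_norm_sub_const_sq (continuous_sEmp hz).aestronglyMeasurable
    (fun x => norm_sEmp_le x hz)]
  gcongr
  · exact variance_sEmp_le γ hn hz hr
  · exact norm_integral_sEmp_sub_sLim_le hn hi hc hc1 hz hR hzR hr hτ

end Quantitative

end Wishart

/-! ### The limiting spectral measure -/

namespace Wishart

open Matrix

theorem sum_eigenvalues_sq {ι : Type*} [Fintype ι] [DecidableEq ι] {A : Matrix ι ι ℝ}
    (hA : A.IsHermitian) : ∑ i, hA.eigenvalues i ^ 2 = (A * A).trace := by
  have h := hA.shift_eq_spectralMatrix 0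
  have h0 : A.shift 0 = A.map Complex.ofRealHom := by simp [shift]
  simp only [sub_zero] at h
  have h2 : ((A * A).trace : ℂ) = ((A * A).map Complex.ofRealHom).trace := by
    simp only [trace, diag_apply, map_apply, Complex.ofReal_sum]
    rfl
  have h3 : ((A * A).trace : ℂ) = ∑ i, (hA.eigenvalues i : ℂ) ^ 2 := by
    rw [h2, Matrix.map_mul, ← h0, h, hA.spectralMatrix_mul, hA.trace_spectralMatrix]
    exact Finset.sum_congr rfl fun i _ => (sq _).symm
  exact_mod_cast h3.symm

theorem sum_eigenvalues_sq_blockMatrix {n m : ℕ} (x : Fin m → EuclideanSpace ℝ (Fin n)) :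
    ∑ i, (blockMatrix_isHermitian x).eigenvalues i ^ 2 = 2 * ∑ j, ‖col x j‖ ^ 2 := by
  have h1 : (blockMatrix x * blockMatrix x).trace =
      ((columnMatrix x)ᵀ * columnMatrix x).trace + (columnMatrix x * (columnMatrix x)ᵀ).trace := by
    rw [blockMatrix, fromBlocks_multiply, conjTranspose_eq_transpose_of_trivial]
    simp [trace, Fintype.sum_sum_type]
  have h2 : (columnMatrix x * (columnMatrix x)ᵀ).trace = ∑ j, ‖col x j‖ ^ 2 := by
    rw [columnMatrix_mul_transpose, gram, trace_sum]
    refine Finset.sum_congr rfl fun j _ => ?_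
    rw [trace_vecMulVec, EuclideanSpace.norm_sq_eq]
    simp [dotProduct, sq]
  rw [sum_eigenvalues_sq, h1, trace_mul_comm, h2]
  ring

theorem integral_sum_norm_col_sq {n m : ℕ} {C : ℝ} {γ : Measure (EuclideanSpace ℝ (Fin n))}
    [IsProbabilityMeasure γ] (hn : 1 ≤ n) (hi : Isotropic γ) (hc : LipschitzConcentration C γ) :
    Integrable (fun x => ∑ j, ‖col x j‖ ^ 2) (Measure.pi fun _ : Fin m => γ) ∧
      ∫ x, ∑ j, ‖col x j‖ ^ 2 ∂(Measure.pi fun _ : Fin m => γ) = m := by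
  have hn0 : (0 : ℝ) < n := by exact_mod_cast hn
  have e1 : ∀ (x : Fin m → EuclideanSpace ℝ (Fin n)) j,
      ‖col x j‖ ^ 2 = (n : ℝ)⁻¹ * ∑ i, x j i * x j i := fun x j => by
    rw [col, norm_smul, mul_pow, norm_inv, inv_pow, Real.norm_of_nonneg (Real.sqrt_nonneg _),
      Real.sq_sqrt hn0.le, EuclideanSpace.norm_sq_eq]
    simp [sq]
  have i0 : Integrable (fun y : EuclideanSpace ℝ (Fin n) => (n : ℝ)⁻¹ * ∑ i, y i * y i) γ :=
    (integrable_finsetSum _ fun i _ => hc.integrable_coord_mul i i).const_mul _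
  have v0 : ∫ y : EuclideanSpace ℝ (Fin n), (n : ℝ)⁻¹ * ∑ i, y i * y i ∂γ = 1 := by
    rw [integral_const_mul, integral_finsetSum _ fun i _ => hc.integrable_coord_mul i i]
    simp only [hi _ _, if_true]
    simp [hn0.ne']
  have i1 : ∀ j : Fin m, Integrable (fun x : Fin m → EuclideanSpace ℝ (Fin n) => ‖col x j‖ ^ 2)
      (Measure.pi fun _ : Fin m => γ) := fun j => by
    simp only [e1]
    exact (measurePreserving_eval (fun _ : Fin m => γ) j).integrable_comp_of_integrable i0
  refine ⟨integrable_finsetSum _ fun j _ => i1 j, ?_⟩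
  rw [integral_finsetSum _ fun j _ => i1 j]
  have v1 : ∀ j : Fin m, ∫ x : Fin m → EuclideanSpace ℝ (Fin n), ‖col x j‖ ^ 2
      ∂(Measure.pi fun _ : Fin m => γ) = 1 := fun j => by
    simp only [e1]
    have hmp := measurePreserving_eval (fun _ : Fin m => γ) j
    rw [← v0]
    conv_rhs => rw [← hmp.map_eq]
    rw [integral_map hmp.measurable.aemeasurable (by fun_prop)]
  simp [v1]

/-- The Stieltjes transform at a nonreal point is weakly continuous. -/
theorem continuous_stieltjes {z : ℂ} (hz : z.im ≠ 0) :
    Continuous fun F : ProbabilityMeasure ℝ => stieltjes (F : Measure ℝ) z := by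
  have hcont : Continuous fun x : ℝ => ((x : ℂ) - z)⁻¹ :=
    (by fun_prop : Continuous fun x : ℝ => (x : ℂ) - z).inv₀ fun x h => hz (by
      rw [← sub_eq_zero.1 h]; simp)
  have hbound : ∀ x : ℝ, ‖((x : ℂ) - z)⁻¹‖ ≤ 1 / |z.im| := fun x => by
    rw [norm_inv, inv_eq_one_div]
    refine one_div_le_one_div_of_le (abs_pos.2 hz) ?_
    simpa using Complex.abs_im_le_norm ((x : ℂ) - z)
  let re := BoundedContinuousFunction.ofNormedAddCommGroup (fun x : ℝ => (((x : ℂ) - z)⁻¹).re)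
    (Complex.continuous_re.comp hcont) _ fun x =>
      (Complex.abs_re_le_norm _).trans (hbound x)
  let im := BoundedContinuousFunction.ofNormedAddCommGroup (fun x : ℝ => (((x : ℂ) - z)⁻¹).im)
    (Complex.continuous_im.comp hcont) _ fun x =>
      (Complex.abs_im_le_norm _).trans (hbound x)
  have e : ∀ F : ProbabilityMeasure ℝ, stieltjes (F : Measure ℝ) z =
      ((∫ x, re x ∂(F : Measure ℝ) : ℝ) : ℂ) +
        ((∫ x, im x ∂(F : Measure ℝ) : ℝ) : ℂ) * Complex.I := fun F =>
    (integral_re_add_im (Integrable.of_bound (μ := (F : Measure ℝ))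
      hcont.aestronglyMeasurable _ (.of_forall hbound))).symm
  simp only [e]
  have h1 := ProbabilityMeasure.continuous_integral_boundedContinuousFunction re
  have h2 := ProbabilityMeasure.continuous_integral_boundedContinuousFunction im
  fun_prop

theorem isProbabilityMeasure_empiricalSpectral {ι : Type*} [Fintype ι] [DecidableEq ι] [Nonempty ι]
    {A : Matrix ι ι ℝ} (hA : A.IsHermitian) : IsProbabilityMeasure (empiricalSpectral hA) := by
  refine ⟨?_⟩
  rw [empiricalSpectral, Measure.smul_apply, Measure.finsetSum_apply]
  simp only [measure_univ, Finset.sum_const, Finset.card_univ, nsmul_eq_mul, mul_one, smul_eq_mul]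
  exact ENNReal.inv_mul_cancel (by simp) (by simp)

/-- Chebyshev's inequality for the spectral measure. -/
theorem empiricalSpectral_compl_Icc_le {ι : Type*} [Fintype ι] [DecidableEq ι] [Nonempty ι]
    {A : Matrix ι ι ℝ} (hA : A.IsHermitian) {M : ℝ}
    (hM : ∑ i, hA.eigenvalues i ^ 2 ≤ M * Fintype.card ι) {r : ℝ} (hr : 0 < r) :
    (empiricalSpectral hA).real (Set.Icc (-r) r)ᶜ ≤ M / r ^ 2 := by
  have := isProbabilityMeasure_empiricalSpectral hA
  have hcard : (0 : ℝ) < Fintype.card ι := by exact_mod_cast Fintype.card_pos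
  have i0 : Integrable (fun x : ℝ => x ^ 2) (empiricalSpectral hA) :=
    Integrable.smul_measure (integrable_finsetSum_measure.2 fun i _ => integrable_dirac (by simp))
      (by simp)
  have e : ∫ x, x ^ 2 ∂(empiricalSpectral hA) =
      (∑ i, hA.eigenvalues i ^ 2) / Fintype.card ι := by
    rw [empiricalSpectral, integral_smul_measure,
      integral_finsetSum_measure fun i _ => integrable_dirac (by simp)]
    simp only [integral_dirac]
    rw [ENNReal.toReal_inv, ENNReal.toReal_natCast, smul_eq_mul, div_eq_inv_mul]
  have h := mul_meas_ge_le_integral_of_nonneg (.of_forall fun x => sq_nonneg x) i0 (r ^ 2)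
  rw [e] at h
  have hsub : (Set.Icc (-r) r)ᶜ ⊆ {x : ℝ | r ^ 2 ≤ x ^ 2} := fun x hx => by
    rw [Set.mem_ofPred_eq, sq_le_sq, abs_of_pos hr]
    by_contra! h
    exact hx (abs_le.1 h.le)
  rw [le_div_iff₀ (by positivity), mul_comm]
  calc _ ≤ r ^ 2 * (empiricalSpectral hA).real {x : ℝ | r ^ 2 ≤ x ^ 2} :=
        mul_le_mul_of_nonneg_left (measureReal_mono hsub) (sq_nonneg r)
    _ ≤ _ := h
    _ ≤ M := (div_le_iff₀ hcard).2 hM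

/-- If finitely many values of `sLim c` can always be approximated by empirical Stieltjes
transforms with bounded second moment, then `sLim c` is a Stieltjes transform: the spectral
measures lie in a weakly compact set. -/
theorem exists_stieltjes_eq_sLim {c : ℝ}
    (h : ∀ u : Finset ({z : ℂ // z.im ≠ 0} × {ε : ℝ // 0 < ε}),
      ∃ (n m : ℕ) (x : Fin m → EuclideanSpace ℝ (Fin n)), 1 ≤ n ∧
        (∀ p ∈ u, ‖sEmp x p.1 - sLim c p.1‖ ≤ p.2) ∧ ∑ j, ‖col x j‖ ^ 2 ≤ 2 * m) :
    ∃ F : Measure ℝ, IsProbabilityMeasure F ∧ ∀ z : ℂ, z.im ≠ 0 → stieltjes F z = sLim c z := by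
  let t : {z : ℂ // z.im ≠ 0} × {ε : ℝ // 0 < ε} → Set (ProbabilityMeasure ℝ) := fun p =>
    {F | ‖stieltjes (F : Measure ℝ) p.1 - sLim c p.1‖ ≤ p.2}
  have ht : ∀ p, IsClosed (t p) := fun p =>
    isClosed_le ((continuous_stieltjes p.1.2).sub continuous_const).norm continuous_const
  have hu : Tendsto (fun k : ℕ => (4 : NNReal) / (k + 1)) atTop (𝓝 0) := by
    have h1 := (tendsto_const_div_atTop_nhds_zero_nat (4 : ℝ)).comp (tendsto_add_atTop_nat 1)
    refine NNReal.tendsto_coe.1 (h1.congr fun k => ?_)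
    simp
  have hcpt := isCompact_setOfPred_probabilityMeasure_mass_eq_compl_isCompact_le
    (K := fun k : ℕ => Set.Icc (-((k : ℝ) + 1)) (k + 1)) hu (fun k => isCompact_Icc)
    (Or.inl inferInstance)
  obtain ⟨F, -, hF⟩ := hcpt.inter_iInter_nonempty t ht fun u => by
    obtain ⟨n, m, x, hn, hx, hx2⟩ := h u
    have : Nonempty (Fin m ⊕ Fin n) := ⟨Sum.inr ⟨0, hn⟩⟩
    have hp := isProbabilityMeasure_empiricalSpectral (blockMatrix_isHermitian x)
    refine ⟨⟨empiricalSpectral (blockMatrix_isHermitian x), hp⟩, fun k => ?_,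
      Set.mem_iInter₂.2 fun p hpu => hx p hpu⟩
    have hk : (0 : ℝ) < (k : ℝ) + 1 := by positivity
    have hM : ∑ i, (blockMatrix_isHermitian x).eigenvalues i ^ 2 ≤
        4 * Fintype.card (Fin m ⊕ Fin n) := by
      rw [sum_eigenvalues_sq_blockMatrix, Fintype.card_sum, Fintype.card_fin, Fintype.card_fin]
      push_cast
      have : (0 : ℝ) ≤ n := Nat.cast_nonneg n
      linarith
    have h1 := empiricalSpectral_compl_Icc_le _ hM hk
    have h2 : 4 / ((k : ℝ) + 1) ^ 2 ≤ 4 / (k + 1) := by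
      gcongr
      exact le_self_pow₀ (by linarith [(Nat.cast_nonneg k : (0 : ℝ) ≤ k)]) (by norm_num)
    refine NNReal.coe_le_coe.1 ?_
    push_cast
    exact h1.trans h2
  refine ⟨F, F.2, fun z hz => ?_⟩
  rw [← sub_eq_zero, ← norm_le_zero_iff]
  refine le_of_forall_pos_le_add fun ε hε => ?_
  rw [zero_add]
  exact Set.mem_iInter.1 hF (⟨z, hz⟩, ⟨ε, hε⟩)

/-- Random columns provide the approximations required by `exists_stieltjes_eq_sLim`: the expected
sum of the normalized square errors and of the normalized second moment is at most one. -/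
theorem exists_forall_norm_sEmp_sub_sLim_le {n m : ℕ} {C c r τ R : ℝ}
    {γ : Measure (EuclideanSpace ℝ (Fin n))} [IsProbabilityMeasure γ] (hn : 1 ≤ n) (hm : 1 ≤ m)
    (hi : Isotropic γ) (hc : LipschitzConcentration C γ) (hc1 : 1 ≤ c) (hR : 1 ≤ R)
    (hr : (m : ℝ) / n ≤ r) (hτ : |(m : ℝ) / n - c| ≤ τ / n)
    (u : Finset ({z : ℂ // z.im ≠ 0} × {ε : ℝ // 0 < ε})) (hu : ∀ p ∈ u, ‖(p.1 : ℂ)‖ ≤ R)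
    (hsmall : ∑ p ∈ u, (16 * r * (|(p.1 : ℂ).im|⁻¹ ^ 2 / n) +
      (rateConst C r τ R * (|(p.1 : ℂ).im|⁻¹ ^ 12 / n)) ^ 2) / (p.2 : ℝ) ^ 2 ≤ 1 / 2) :
    ∃ x : Fin m → EuclideanSpace ℝ (Fin n),
      (∀ p ∈ u, ‖sEmp x p.1 - sLim c p.1‖ ≤ p.2) ∧ ∑ j, ‖col x j‖ ^ 2 ≤ 2 * m := by
  have hm0 : (0 : ℝ) < m := by exact_mod_cast hm
  obtain ⟨iT, vT⟩ := integral_sum_norm_col_sq (m := m) hn hi hc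
  have hL2 := fun p (hp : p ∈ u) =>
    integral_norm_sEmp_sub_sLim_sq_le (m := m) hn hi hc hc1 p.1.2 hR (hu p hp) hr hτ
  set π := Measure.pi fun _ : Fin m => γ with hπ
  have iS : ∀ p : {z : ℂ // z.im ≠ 0} × {ε : ℝ // 0 < ε},
      Integrable (fun x : Fin m → EuclideanSpace ℝ (Fin n) =>
        ‖sEmp x p.1 - sLim c p.1‖ ^ 2 / (p.2 : ℝ) ^ 2) π := fun p => by
    have hcont := continuous_sEmp (n := n) (m := m) p.1.2
    refine Integrable.div_const (.of_bound (by fun_prop)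
      ((1 / |(p.1 : ℂ).im| + ‖sLim c p.1‖) ^ 2) (.of_forall fun x => ?_)) _
    rw [Real.norm_of_nonneg (by positivity)]
    gcongr
    exact (norm_sub_le _ _).trans (by gcongr; exact norm_sEmp_le x p.1.2)
  have iSum := integrable_finsetSum u fun p _ => iS p
  obtain ⟨x, hx⟩ := exists_le_integral (iSum.add (iT.div_const (2 * m)))
  simp only [Pi.add_apply] at hx
  rw [integral_add iSum (iT.div_const _), integral_finsetSum u fun p _ => iS p, integral_div, vT]
    at hx
  have h1 : ∑ p ∈ u, ∫ x : Fin m → EuclideanSpace ℝ (Fin n),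
      ‖sEmp x p.1 - sLim c p.1‖ ^ 2 / (p.2 : ℝ) ^ 2 ∂π ≤ 1 / 2 := by
    refine le_trans (Finset.sum_le_sum fun p hp => ?_) hsmall
    rw [integral_div]
    gcongr
    exact hL2 p hp
  have h2 : (m : ℝ) / (2 * m) = 1 / 2 := by field_simp
  rw [h2] at hx
  have hT0 : 0 ≤ (∑ j, ‖col x j‖ ^ 2) / (2 * m) := by positivity
  have hS0 : ∀ p ∈ u, 0 ≤ ‖sEmp x p.1 - sLim c p.1‖ ^ 2 / (p.2 : ℝ) ^ 2 := fun p _ => by positivity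
  refine ⟨x, fun p hp => ?_, ?_⟩
  · have h3 := Finset.single_le_sum hS0 hp
    have h4 : ‖sEmp x p.1 - sLim c p.1‖ ^ 2 / (p.2 : ℝ) ^ 2 ≤ 1 := by linarith
    rw [div_le_one (by have := p.2.2; positivity)] at h4
    exact le_of_sq_le_sq h4 p.2.2.le
  · have h3 := Finset.sum_nonneg hS0
    have h4 : (∑ j, ‖col x j‖ ^ 2) / (2 * m) ≤ 1 := by linarith
    rwa [div_le_one (by positivity)] at h4

/-- Independent columns with the same law have a product law. -/
theorem hasLaw_columns {Ω E : Type*} [MeasurableSpace Ω] [MeasurableSpace E] {P : Measure Ω}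
    [IsProbabilityMeasure P] {m : ℕ} {γ : Measure E} {X : Fin m → Ω → E}
    (hX : ∀ j, HasLaw (X j) γ P) (hindep : iIndepFun X P) :
    HasLaw (fun ω j => X j ω) (Measure.pi fun _ => γ) P := by
  refine ⟨aemeasurable_pi_lambda _ fun j => (hX j).aemeasurable, ?_⟩
  rw [(iIndepFun_iff_map_fun_eq_pi_map fun j => (hX j).aemeasurable).1 hindep]
  simp only [(hX _).map_eq]

end Wishart

/-! ### Convergence along the sequence -/

namespace Wishart

theorem rateConst_nonneg {C r τ R : ℝ} (hr : 0 ≤ r) (hτ : 0 ≤ τ) (hR : 0 ≤ R) :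
    0 ≤ rateConst C r τ R := by
  have := formConst_pos C
  rw [rateConst]
  positivity

section Transfer

variable {Ω : Type*} [MeasurableSpace Ω] {P : Measure Ω} [IsProbabilityMeasure P] {n m : ℕ}
  {Y : Ω → Fin m → EuclideanSpace ℝ (Fin n)} {z : ℂ}

theorem memLp_sEmp_sub (hY : AEMeasurable Y P) (hz : z.im ≠ 0) (a : ℂ) (p : ℝ≥0∞) :
    MemLp (fun ω => sEmp (Y ω) z - a) p P :=
  (MemLp.of_bound ((continuous_sEmp hz).measurable.comp_aemeasurable hY).aestronglyMeasurable
    (1 / |z.im|) (.of_forall fun ω => norm_sEmp_le (Y ω) hz)).sub (memLp_const a)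

variable {γ : Measure (EuclideanSpace ℝ (Fin n))} [IsProbabilityMeasure γ] {C c r τ R : ℝ}

theorem eLpNorm_sEmp_sub_sLim_le (hY : HasLaw Y (Measure.pi fun _ => γ) P) (hn : 1 ≤ n)
    (hi : Isotropic γ) (hc : LipschitzConcentration C γ) (hc1 : 1 ≤ c) (hz : z.im ≠ 0)
    (hR : 1 ≤ R) (hzR : ‖z‖ ≤ R) (hr : (m : ℝ) / n ≤ r) (hτ : |(m : ℝ) / n - c| ≤ τ / n) :
    eLpNorm (fun ω => sEmp (Y ω) z - sLim c z) 2 P ≤ ENNReal.ofReal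
      √(16 * r * (|z.im|⁻¹ ^ 2 / n) + (rateConst C r τ R * (|z.im|⁻¹ ^ 12 / n)) ^ 2) := by
  have hcont : Continuous fun x : Fin m → EuclideanSpace ℝ (Fin n) => ‖sEmp x z - sLim c z‖ ^ 2 :=
    ((continuous_sEmp hz).sub continuous_const).norm.pow 2
  have h := hY.integral_comp hcont.aestronglyMeasurable
  rw [(memLp_sEmp_sub hY.aemeasurable hz _ 2).eLpNorm_eq_integral_rpow_norm two_ne_zero
    ENNReal.ofNat_ne_top, ENNReal.toReal_ofNat, Real.sqrt_eq_rpow, one_div]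
  refine ENNReal.ofReal_le_ofReal (Real.rpow_le_rpow (by positivity) ?_ (by norm_num))
  simp only [Real.rpow_ofNat]
  exact h.trans_le (integral_norm_sEmp_sub_sLim_sq_le hn hi hc hc1 hz hR hzR hr hτ)

end Transfer

/-- On the scale `v ≥ n^(-1/13)` the error terms, which carry at most twelve powers of `v⁻¹`,
still tend to zero. -/
theorem inv_pow_div_le {n : ℕ} (hn : 1 ≤ n) {v : ℝ} (hv : (n : ℝ) ^ (-(1 / 13) : ℝ) ≤ v) {j : ℕ}
    (hj : j ≤ 12) : v⁻¹ ^ j / n ≤ (n : ℝ) ^ (-(1 / 13) : ℝ) := by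
  have hn1 : (1 : ℝ) ≤ n := by exact_mod_cast hn
  have hn0 : (0 : ℝ) < n := by linarith
  have hw : 0 < (n : ℝ) ^ (-(1 / 13) : ℝ) := Real.rpow_pos_of_pos hn0 _
  have h1 : v⁻¹ ≤ (n : ℝ) ^ (1 / 13 : ℝ) := by
    rw [inv_le_comm₀ (hw.trans_le hv) (Real.rpow_pos_of_pos hn0 _), ← Real.rpow_neg hn0.le]
    exact hv
  have h2 : v⁻¹ ^ j ≤ (n : ℝ) ^ (12 / 13 : ℝ) :=
    calc v⁻¹ ^ j ≤ ((n : ℝ) ^ (1 / 13 : ℝ)) ^ j :=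
          pow_le_pow_left₀ (inv_nonneg.2 (hw.le.trans hv)) h1 j
      _ ≤ ((n : ℝ) ^ (1 / 13 : ℝ)) ^ 12 :=
          pow_le_pow_right₀ (Real.one_le_rpow hn1 (by norm_num)) hj
      _ = (n : ℝ) ^ (12 / 13 : ℝ) := by
          rw [← Real.rpow_natCast, ← Real.rpow_mul hn0.le]; norm_num
  rw [div_le_iff₀ hn0]
  refine h2.trans_eq ?_
  nth_rewrite 3 [← Real.rpow_one (n : ℝ)]
  rw [← Real.rpow_add hn0]
  norm_num

theorem eventually_ratio_bounds {c σ : ℝ} (hc : 1 ≤ c) {n m : ℕ → ℕ} (hn : Tendsto n atTop atTop)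
    (hmn : Tendsto (fun k => (m k : ℝ) / (n k : ℝ)) atTop (𝓝 c))
    (hσ : Tendsto (fun k => c * (n k : ℝ) - (m k : ℝ)) atTop (𝓝 σ)) :
    ∀ᶠ k in atTop, 1 ≤ n k ∧ 1 ≤ m k ∧ (m k : ℝ) / n k ≤ c + 1 ∧
      |(m k : ℝ) / n k - c| ≤ (|σ| + 1) / n k := by
  filter_upwards [hn.eventually_ge_atTop 1, hmn.eventually_lt_const (lt_add_one c),
    hmn.eventually_const_lt (show 0 < c by linarith),
    hσ.abs.eventually_lt_const (lt_add_one |σ|)] with k h1 h2 h3 h4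
  have hn0 : (0 : ℝ) < n k := by exact_mod_cast h1
  refine ⟨h1, Nat.one_le_iff_ne_zero.2 fun h => ?_, h2.le, ?_⟩
  · simp [h] at h3
  · rw [abs_sub_comm, ← mul_div_cancel_right₀ c hn0.ne', ← sub_div, abs_div, abs_of_pos hn0]
    gcongr

end Wishart

end

theorem mainTheorem4
    (C μ c σ : ℝ) (hC : 0 < C) (hc : 1 ≤ c)
    (n m : ℕ → ℕ) (hn : Tendsto n atTop atTop)
    (hmn : Tendsto (fun k => (m k : ℝ) / (n k : ℝ)) atTop (𝓝 c))
    (hσ : Tendsto (fun k => c * (n k : ℝ) - (m k : ℝ)) atTop (𝓝 σ))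
    (V : ∀ k, EuclideanSpace ℝ (Fin (n k)) → ℝ)
    (hV : ∀ k, Wishart.ColumnLaw C μ (V k))
    {Ω : ℕ → Type*} [∀ k, MeasurableSpace (Ω k)]
    (P : ∀ k, Measure (Ω k)) [∀ k, IsProbabilityMeasure (P k)]
    (X : ∀ k, Fin (m k) → Ω k → EuclideanSpace ℝ (Fin (n k)))
    (hlaw : ∀ k j, HasLaw (X k j) (Wishart.gibbs (V k)) (P k))
    (hindep : ∀ k, iIndepFun (X k) (P k)) :
    -- the limit `s`: its closed form, and `s` is the Stieltjes transform of a probability measure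
    (∀ z : ℂ, z.im ≠ 0 →
      Wishart.sLim c z = -(1 / (1 + (c : ℂ))) * (z - Wishart.branchSqrt c z / z)) ∧
    (∃ F : Measure ℝ, IsProbabilityMeasure F ∧
      ∀ z : ℂ, z.im ≠ 0 → Wishart.stieltjes F z = Wishart.sLim c z) ∧
    -- `s_{n,m}(z)` is a square integrable random variable
    (∀ k, ∀ z : ℂ, z.im ≠ 0 →
      MemLp (fun ω => Wishart.sEmp (fun j => X k j ω) z) 2 (P k)) ∧
    -- uniform convergence in `L²`
    (∀ R : ℝ, ∀ v₀ : ℕ → ℝ, (∀ᶠ k in atTop, (n k : ℝ) ^ (-(1 / 13) : ℝ) ≤ v₀ k) →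
      Tendsto (fun k => ⨆ z ∈ Wishart.domain (v₀ k) R,
          eLpNorm (fun ω => Wishart.sEmp (fun j => X k j ω) z - Wishart.sLim c z) 2 (P k))
        atTop (𝓝 0)) ∧
    -- rate of convergence of the expectation
    (∀ R : ℝ, ∃ K : ℝ, ∀ᶠ k in atTop, ∀ v₀ : ℝ, (n k : ℝ) ^ (-(1 / 13) : ℝ) ≤ v₀ →
      ∀ z ∈ Wishart.domain v₀ R,
        ‖(∫ ω, Wishart.sEmp (fun j => X k j ω) z ∂(P k)) - Wishart.sLim c z‖
          ≤ K * (v₀⁻¹ ^ 12 / (n k : ℝ))) := by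
  open Wishart in
  have hY : ∀ k, 1 ≤ m k → IsProbabilityMeasure (gibbs (V k)) := fun k hk =>
    (hlaw k ⟨0, hk⟩).isProbabilityMeasure_iff.1 inferInstance
  have hreg := eventually_ratio_bounds hc hn hmn hσ
  have hlaws := fun k => hasLaw_columns (hlaw k) (hindep k)
  have hn' : Tendsto (fun k => (n k : ℝ)) atTop atTop := tendsto_natCast_atTop_atTop.comp hn
  refine ⟨fun z hz => sLim_eq_branchSqrt (by linarith) (by rintro rfl; simp at hz), ?_,
    fun k z hz => ?_, fun R v₀ hv₀ => ?_, fun R => ?_⟩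
  · refine exists_stieltjes_eq_sLim fun u => ?_
    -- `1 + ∑ ‖z‖` is a radius valid at all the finitely many points
    have hlim : Tendsto (fun k => ∑ p ∈ u, (16 * (c + 1) * (|(p.1 : ℂ).im|⁻¹ ^ 2 / n k) +
        (rateConst C (c + 1) (|σ| + 1) (1 + ∑ p ∈ u, ‖(p.1 : ℂ)‖) *
          (|(p.1 : ℂ).im|⁻¹ ^ 12 / n k)) ^ 2) / (p.2 : ℝ) ^ 2) atTop (𝓝 0) := by
      refine (tendsto_finsetSum (a := fun _ => (0 : ℝ)) u fun p _ => ?_).trans (by simp)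
      have h1 := (hn'.const_div_atTop (|(p.1 : ℂ).im|⁻¹ ^ 2)).const_mul (16 * (c + 1))
      have h2 := ((hn'.const_div_atTop (|(p.1 : ℂ).im|⁻¹ ^ 12)).const_mul
        (rateConst C (c + 1) (|σ| + 1) (1 + ∑ p ∈ u, ‖(p.1 : ℂ)‖))).pow 2
      simpa using (h1.add h2).div_const ((p.2 : ℝ) ^ 2)
    obtain ⟨k, ⟨h1, h2, h3, h4⟩, h5⟩ :=
      (hreg.and (hlim.eventually_le_const (show (0 : ℝ) < 1 / 2 by norm_num))).exists
    have := hY k h2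
    have hnn : ∀ p ∈ u, 0 ≤ ‖(p.1 : ℂ)‖ := fun p _ => norm_nonneg _
    obtain ⟨x, hx⟩ := exists_forall_norm_sEmp_sub_sLim_le h1 h2 (hV k).covariance
      ((hV k).lipschitzConcentration hC) hc (le_add_of_nonneg_right (Finset.sum_nonneg hnn)) h3 h4 u
      (fun p hp => (Finset.single_le_sum hnn hp).trans (le_add_of_nonneg_left zero_le_one)) h5
    exact ⟨n k, m k, x, h1, hx⟩
  · simpa using memLp_sEmp_sub (hlaws k).aemeasurable hz 0 2
  -- the radius is enlarged to at least one, as the quantitative bounds require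
  · set K := rateConst C (c + 1) (|σ| + 1) (max R 1) with hK
    have hK0 : 0 ≤ K := rateConst_nonneg (by linarith) (by positivity) (by positivity)
    have hw : Tendsto (fun k => (n k : ℝ) ^ (-(1 / 13) : ℝ)) atTop (𝓝 0) :=
      (tendsto_rpow_neg_atTop (by norm_num : (0 : ℝ) < 1 / 13)).comp hn'
    have hlim : Tendsto (fun k => ENNReal.ofReal √(16 * (c + 1) * (n k : ℝ) ^ (-(1 / 13) : ℝ) +
        (K * (n k : ℝ) ^ (-(1 / 13) : ℝ)) ^ 2)) atTop (𝓝 0) := by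
      have h := ((hw.const_mul (16 * (c + 1))).add ((hw.const_mul K).pow 2)).sqrt
      simpa using ENNReal.tendsto_ofReal h
    refine tendsto_of_tendsto_of_tendsto_of_le_of_le' tendsto_const_nhds hlim
      (.of_forall fun k => zero_le) ?_
    filter_upwards [hreg, hv₀] with k ⟨h1, h2, h3, h4⟩ hv
    have := hY k h2
    refine iSup₂_le fun z hz => ?_
    have hv1 := hv.trans hz.1
    have hz0 : 0 < |z.im| :=
      (Real.rpow_pos_of_pos (by exact_mod_cast h1) _).trans_le hv1
    refine (eLpNorm_sEmp_sub_sLim_le (hlaws k) h1 (hV k).covariance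
      ((hV k).lipschitzConcentration hC) hc (abs_pos.1 hz0) (le_max_right R 1)
      (hz.2.le.trans (le_max_left R 1)) h3 h4).trans ?_
    rw [← hK]
    gcongr
    · exact inv_pow_div_le h1 hv1 (by norm_num)
    · exact inv_pow_div_le h1 hv1 le_rfl
  · refine ⟨rateConst C (c + 1) (|σ| + 1) (max R 1), ?_⟩
    filter_upwards [hreg] with k ⟨h1, h2, h3, h4⟩ v₀ hv z hz
    have := hY k h2
    have hv0 : 0 < v₀ := (Real.rpow_pos_of_pos (by exact_mod_cast h1) _).trans_le hv
    have hz0 : 0 < |z.im| := hv0.trans_le hz.1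
    have h := (hlaws k).integral_comp
      (continuous_sEmp (abs_pos.1 hz0)).aestronglyMeasurable
    rw [Function.comp_def] at h
    rw [h]
    refine (norm_integral_sEmp_sub_sLim_le h1 (hV k).covariance
      ((hV k).lipschitzConcentration hC) hc (abs_pos.1 hz0) (le_max_right R 1)
      (hz.2.le.trans (le_max_left R 1)) h3 h4).trans ?_
    have hK0 : 0 ≤ rateConst C (c + 1) (|σ| + 1) (max R 1) :=
      rateConst_nonneg (by linarith) (by positivity) (by positivity)
    gcongr
    exact hz.1
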